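/- Call a vector of $\mathbb{C}^2\otimes\mathbb{C}^3\cong\mathbb{C}^6$ a product state if it has the form $\phi\otimes\Phi$ with unit vectors $\phi\in\mathbb{C}^2$ and $\Phi\in\mathbb{C}^3$. Two families of unit vectors $(u_i)$ and $(v_k)$ of $\mathbb{C}^6$ are mutually unbiased (MU) if $|\langle u_i,v_k\rangle|^2=1/6$ for all $i,k$. A product constellation $\{5,5,4\}^{\otimes}_6$ consists of two orthonormal bases $\mathcal{A}_1,\mathcal{A}_2$ of $\mathbb{C}^2\otimes\mathbb{C}^3$ all of whose members are product states, together with four orthonormal product states $\mathcal{S}=\{s_1,\dots,s_4\}$, such that $\mathcal{A}_1$, $\mathcal{A}_2$ and $\mathcal{S}$ are pairwise MU. Theorem. No product constellation $\{5,5,4\}^{\otimes}_6$ is part of a complete set of seven MU bases: there do not exist seven pairwise MU orthonormal bases of $\mathbb{C}^2\otimes\mathbb{C}^3$ such that each of the sixteen states in $\mathcal{A}_1\cup\mathcal{A}_2\cup\mathcal{S}$ is, up to a phase factor, a member of one of these bases. -/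

import Mathlib

open scoped TensorProduct InnerProductSpace

/-- The six-dimensional Hilbert space `ℂ² ⊗ ℂ³`, with the tensor-product inner product. -/
abbrev QubitQutrit : Type :=
  EuclideanSpace ℂ (Fin 2) ⊗[ℂ] EuclideanSpace ℂ (Fin 3)

/-- A product state of `ℂ² ⊗ ℂ³`: a vector `φ ⊗ Φ` with unit vectors `φ ∈ ℂ²`, `Φ ∈ ℂ³`. -/
def IsProductState (v : QubitQutrit) : Prop :=
  ∃ (φ : EuclideanSpace ℂ (Fin 2)) (Φ : EuclideanSpace ℂ (Fin 3)),
    ‖φ‖ = 1 ∧ ‖Φ‖ = 1 ∧ v = φ ⊗ₜ[ℂ] Φ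

/-- Two families of states of `ℂ² ⊗ ℂ³` are mutually unbiased: every squared modulus of an
inner product between the families equals `1 / 6`. -/
def MutuallyUnbiased {ι κ : Type*} (u : ι → QubitQutrit) (v : κ → QubitQutrit) : Prop :=
  ∀ i k, ‖⟪u i, v k⟫_ℂ‖ ^ 2 = 1 / 6

/-- Two vectors represent the same state if they differ by a phase factor. -/
def SameState (v w : QubitQutrit) : Prop :=
  ∃ c : ℂ, ‖c‖ = 1 ∧ w = c • v

/-- The mutually unbiased product constellation `{5,5,4}^⊗` in dimension six: two orthonormal
bases `b₁`, `b₂` of product states and four orthonormal product states `s`, the three families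
being pairwise mutually unbiased. -/
structure IsMUProductConstellation554
    (b₁ b₂ : OrthonormalBasis (Fin 6) ℂ QubitQutrit) (s : Fin 4 → QubitQutrit) : Prop where
  product_left : ∀ k, IsProductState (b₁ k)
  product_right : ∀ k, IsProductState (b₂ k)
  product_quad : ∀ k, IsProductState (s k)
  orthonormal_quad : Orthonormal ℂ s
  unbiased_bases : MutuallyUnbiased b₁ b₂
  unbiased_left_quad : MutuallyUnbiased b₁ s
  unbiased_right_quad : MutuallyUnbiased b₂ s

/-- A complete set of mutually unbiased bases in dimension six: seven orthonormal bases, any two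
of which are mutually unbiased. -/
def IsCompleteMUSet (B : Fin 7 → OrthonormalBasis (Fin 6) ℂ QubitQutrit) : Prop :=
  ∀ i j, i ≠ j → MutuallyUnbiased (B i) (B j)

/-- The state `v` occurs, up to a phase factor, in one of the bases `B i`. -/
def OccursIn (v : QubitQutrit) (B : Fin 7 → OrthonormalBasis (Fin 6) ℂ QubitQutrit) : Prop :=
  ∃ i k, SameState v (B i k)

open ComplexConjugate

/-! A product state unbiased to a product basis is unbiased to its qubit factors, by the equality
case of an AM-GM inequality (`qubit_unbiased`). Hence the qubit factors of the three families lie on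
three orthogonal Bloch axes, one axis per family (`qubit_overlap`), and the two bases have the form
`α i ⊗ A i j` (`exists_splits`). In a complete set the four states lie in one basis, whose other
members are then forced to be product states (`isProductState_of_orthogonal`). A vector of any
fourth basis is thus unbiased to three product bases, which `no_vector_unbiased_to_triple` excludes.

For that exclusion, the three Bloch axes make the qubit marginal of the vector maximally mixed
(`inner_contract_eq_zero`). In ℂ³, vectors unbiased to a mutually unbiased pair of bases form two
classes and overlap only in 0, 1 or 1/3 (`exists_class`). So in at least two of the product bases
both qutrit bases consist of the same states (`SplitUnbiased.not_both_unbiased`). The contractions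
of the vector along these two qubit bases span one plane. Its normal is unbiased to the qutrit bases
of both, hence so are the normalised contractions; yet two of them overlap in 1/2
(`not_maximally_entangled`). -/

/-! ### Cube roots of unity. -/

theorem exists_cubeRoot_of_sum_eq_zero {a b c : ℂ} (ha : a * conj a = 1) (hb : b * conj b = 1)
    (hc : c * conj c = 1) (h : a + b + c = 0) :
    ∃ ζ : ℂ, ζ ^ 2 + ζ + 1 = 0 ∧ b = ζ * a ∧ c = ζ * b := by
  have h' : conj a + conj b + conj c = 0 := by
    rw [← map_add, ← map_add, h, map_zero]
  have key : a ^ 2 + a * b + b ^ 2 = 0 := by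
    -- This is the conjugated relation multiplied by `a * b * c`.
    have : a * b + b * c + c * a = 0 := by
      linear_combination (a * b * c) * h' - b * c * ha - a * c * hb - a * b * hc
    linear_combination (a + b) * h - this
  have ha0 : a ≠ 0 := by rintro rfl; simp at ha
  refine ⟨b / a, ?_, ?_, ?_⟩
  · field_simp; linear_combination key
  · field_simp
  · field_simp; linear_combination a * h - key

theorem conj_cubeRoot {ζ : ℂ} (h : ζ ^ 2 + ζ + 1 = 0) : conj ζ = ζ ^ 2 := by
  have h3 : ζ ^ 3 = 1 := by linear_combination (ζ - 1) * h
  have hn : ‖ζ‖ = 1 := by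
    have : ‖ζ‖ ^ 3 = 1 := by rw [← norm_pow, h3, norm_one]
    exact (pow_eq_one_iff_of_nonneg (norm_nonneg _) (by norm_num)).1 this
  have hz : ζ * conj ζ = 1 := by rw [Complex.mul_conj']; simp [hn]
  linear_combination ζ ^ 2 * hz - conj ζ * h3

theorem re_cubeRoot {ζ : ℂ} (h : ζ ^ 2 + ζ + 1 = 0) : ζ.re = -1 / 2 := by
  have h1 : ζ + conj ζ = -1 := by rw [conj_cubeRoot h]; linear_combination h
  have := congrArg Complex.re h1
  simp at this
  linarith

/-- 1 and `ζ` are linearly independent over ℝ. -/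
theorem eq_zero_of_re_mul_cubeRoot {ζ m : ℂ} (h : ζ ^ 2 + ζ + 1 = 0) (h1 : m.re = 0)
    (h2 : (ζ * m).re = 0) : m = 0 := by
  have e1 : m + conj m = 0 := by
    apply Complex.ext <;> simp [h1]
  have e2 : ζ * m + conj (ζ * m) = 0 := by
    apply Complex.ext
    · simp only [Complex.add_re, Complex.conj_re, h2]; simp
    · simp only [Complex.add_im, Complex.conj_im]; simp
  rw [map_mul, conj_cubeRoot h] at e2
  have e3 : (ζ - ζ ^ 2) * m = 0 := by linear_combination e2 - ζ ^ 2 * e1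
  rcases mul_eq_zero.1 e3 with h0 | h0
  · exfalso
    -- `ζ - ζ ^ 2` equals `2 * ζ + 1`, whose square is -3.
    have : (3 : ℂ) = 0 := by linear_combination 4 * h - (2 * ζ + 1) * (h + h0)
    norm_num at this
  · exact h0

/-! ### Unimodular vectors of ℂ³ and their cyclic phase differences. -/

/-- The inner product of the vectors of cyclic phase differences `(p₀ p̄₁, p₁ p̄₂, p₂ p̄₀)` of `p`
and of `q`. -/
def cyclicSum (p q : Fin 3 → ℂ) : ℂ :=
  (p 0 * conj (p 1)) * conj (q 0 * conj (q 1)) + (p 1 * conj (p 2)) * conj (q 1 * conj (q 2))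
    + (p 2 * conj (p 0)) * conj (q 2 * conj (q 0))

theorem normSq_sum_conj_mul {p q : Fin 3 → ℂ} (hp : ∀ j, p j * conj (p j) = 1)
    (hq : ∀ j, q j * conj (q j) = 1) :
    ‖∑ j, conj (q j) * p j‖ ^ 2 = 3 + 2 * (cyclicSum p q).re := by
  have : ((‖∑ j, conj (q j) * p j‖ ^ 2 : ℝ) : ℂ) = 3 + (cyclicSum p q + conj (cyclicSum p q)) := by
    push_cast
    rw [← Complex.mul_conj']
    simp only [Fin.sum_univ_three, cyclicSum, map_add, map_mul, Complex.conj_conj]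
    linear_combination (q 0 * conj (q 0)) * hp 0 + (q 1 * conj (q 1)) * hp 1
      + (q 2 * conj (q 2)) * hp 2 + hq 0 + hq 1 + hq 2
  rw [Complex.add_conj] at this
  exact_mod_cast this

/-- All three cyclic phase differences of `h` equal `conj ζ`. -/
theorem cyclicSum_eq_mul {p h : Fin 3 → ℂ} (hh : h 0 * conj (h 0) = 1) {ζ : ℂ}
    (hζ : ζ ^ 2 + ζ + 1 = 0) (e1 : h 1 = ζ * h 0) (e2 : h 2 = ζ * h 1) :
    cyclicSum p h = ζ * cyclicSum p 1 := by
  have hz3 : ζ ^ 3 = 1 := by linear_combination (ζ - 1) * hζ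
  have hz := conj_cubeRoot hζ
  simp only [cyclicSum, e2, e1, Pi.one_apply, map_mul, map_one, Complex.conj_conj]
  generalize p 0 * conj (p 1) = X₀
  generalize p 1 * conj (p 2) = X₁
  generalize p 2 * conj (p 0) = X₂
  linear_combination (ζ * X₀ + conj ζ * ζ ^ 2 * X₁ + conj ζ ^ 2 * X₂) * hh
    + (ζ ^ 2 * X₁ + (conj ζ + ζ ^ 2) * X₂) * hz + ζ * (X₁ + X₂) * hz3

/-- Up to a phase `h` is `(1, ζ, ζ²)`, so the two overlaps say that the cyclic sum and `ζ` times it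
both have zero real part. -/
theorem cyclicSum_eq_zero_of_unbiased {p h : Fin 3 → ℂ} (hp : ∀ j, p j * conj (p j) = 1)
    (hh : ∀ j, h j * conj (h j) = 1) (hs : ∑ j, h j = 0)
    (h0 : ‖∑ j, p j‖ ^ 2 = 3) (h1 : ‖∑ j, conj (h j) * p j‖ ^ 2 = 3) :
    cyclicSum p 1 = 0 := by
  rw [Fin.sum_univ_three] at hs
  obtain ⟨ζ, hζ, e1, e2⟩ := exists_cubeRoot_of_sum_eq_zero (hh 0) (hh 1) (hh 2) hs
  rw [normSq_sum_conj_mul hp hh] at h1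
  have h0' := normSq_sum_conj_mul (q := 1) hp (by simp)
  simp only [Pi.one_apply, map_one, one_mul] at h0'
  rw [h0] at h0'
  refine eq_zero_of_re_mul_cubeRoot hζ (by linarith) ?_
  rw [← cyclicSum_eq_mul (hh 0) hζ e1 e2]; linarith

theorem unbiased_one_of_cyclicSum_eq_zero {p : Fin 3 → ℂ} (hp : ∀ j, p j * conj (p j) = 1)
    (hm : cyclicSum p 1 = 0) : ‖∑ j, p j‖ ^ 2 = 3 := by
  have h0' := normSq_sum_conj_mul (q := 1) hp (by simp)
  simp only [Pi.one_apply, map_one, one_mul] at h0'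
  rw [h0', hm]
  simp

theorem unbiased_of_cyclicSum_eq_zero {p h : Fin 3 → ℂ} (hp : ∀ j, p j * conj (p j) = 1)
    (hh : ∀ j, h j * conj (h j) = 1) (hs : ∑ j, h j = 0) (hm : cyclicSum p 1 = 0) :
    ‖∑ j, conj (h j) * p j‖ ^ 2 = 3 := by
  rw [Fin.sum_univ_three] at hs
  obtain ⟨ζ, hζ, e1, e2⟩ := exists_cubeRoot_of_sum_eq_zero (hh 0) (hh 1) (hh 2) hs
  rw [normSq_sum_conj_mul hp hh, cyclicSum_eq_mul (hh 0) hζ e1 e2, hm]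
  simp

/-- A unimodular vector orthogonal to `w` has vanishing cyclic sum as soon as `w` has. -/
theorem cyclicSum_eq_zero_of_orthogonal {x w : Fin 3 → ℂ} (hx : ∀ j, x j * conj (x j) = 1)
    (hw : ∀ j, w j * conj (w j) = 1) (h : ∑ j, conj (w j) * x j = 0) (hm : cyclicSum w 1 = 0) :
    cyclicSum x 1 = 0 := by
  rw [Fin.sum_univ_three] at h
  have hu : ∀ j, (conj (w j) * x j) * conj (conj (w j) * x j) = 1 := by
    intro j
    rw [map_mul, Complex.conj_conj]
    linear_combination (w j * conj (w j)) * hx j + hw j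
  obtain ⟨ζ, hζ, e1, e2⟩ := exists_cubeRoot_of_sum_eq_zero (hu 0) (hu 1) (hu 2) h
  have hz3 : ζ ^ 3 = 1 := by linear_combination (ζ - 1) * hζ
  have hz := conj_cubeRoot hζ
  -- Orthogonality gives `x j = ζ ^ j * z * w j`, so all cyclic phase differences of `w` acquire the
  -- same factor.
  set z := conj (w 0) * x 0 with hz0
  have x0 : x 0 = z * w 0 := by linear_combination w 0 * (-hz0) - x 0 * hw 0
  have x1 : x 1 = ζ * z * w 1 := by linear_combination w 1 * e1 - x 1 * hw 1
  have x2 : x 2 = ζ ^ 2 * z * w 2 := by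
    rw [e1] at e2; linear_combination w 2 * e2 - x 2 * hw 2
  simp only [cyclicSum, Pi.one_apply, map_one, mul_one] at hm ⊢
  simp only [x0, x1, x2, map_mul, map_pow, hz]
  linear_combination ζ ^ 2 * z * conj z * hm
    + z * conj z * ζ ^ 2 * (w 1 * conj (w 2)) * hz3

/-- The phase differences of a unimodular vector with vanishing cyclic sum. -/
theorem exists_cubeRoot_of_cyclicSum_eq_zero {p : Fin 3 → ℂ} (hp : ∀ j, p j * conj (p j) = 1)
    (hm : cyclicSum p 1 = 0) : ∃ ζ r : ℂ, ζ ^ 2 + ζ + 1 = 0 ∧ r ^ 3 = 1 ∧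
      p 0 * conj (p 1) = r ∧ p 1 * conj (p 2) = ζ * r ∧ p 2 * conj (p 0) = ζ ^ 2 * r := by
  simp only [cyclicSum, Pi.one_apply, map_one, mul_one] at hm
  have hu : ∀ i j, (p i * conj (p j)) * conj (p i * conj (p j)) = 1 := by
    intro i j
    rw [map_mul, Complex.conj_conj]
    linear_combination (p i * conj (p i)) * hp j + hp i
  obtain ⟨ζ, hζ, e1, e2⟩ := exists_cubeRoot_of_sum_eq_zero (hu 0 1) (hu 1 2) (hu 2 0) hm
  have hz3 : ζ ^ 3 = 1 := by linear_combination (ζ - 1) * hζ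
  refine ⟨ζ, _, hζ, ?_, rfl, e1, by rw [e2, e1]; ring⟩
  -- The cyclic phase differences multiply to 1, which makes `r` a cube root of unity.
  have e3 : (p 0 * conj (p 1)) * (p 1 * conj (p 2)) * (p 2 * conj (p 0)) = 1 := by
    linear_combination (p 0 * conj (p 0)) * (p 1 * conj (p 1)) * hp 2
      + (p 0 * conj (p 0)) * hp 1 + hp 0
  rw [e2, e1] at e3
  linear_combination e3 - (p 0 * conj (p 1)) ^ 3 * hz3

theorem eq_of_cubeRoot {ζ ξ : ℂ} (h : ζ ^ 2 + ζ + 1 = 0) (h' : ξ ^ 2 + ξ + 1 = 0) :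
    ξ = ζ ∨ ξ = ζ ^ 2 := by
  have : (ξ - ζ) * (ξ - ζ ^ 2) = 0 := by linear_combination h' + (-ξ + ζ - 1) * h
  rcases mul_eq_zero.1 this with h | h
  · exact Or.inl (sub_eq_zero.1 h)
  · exact Or.inr (sub_eq_zero.1 h)

theorem cube_eq_one_cases {t : ℂ} (h : t ^ 3 = 1) : t = 1 ∨ t ^ 2 + t + 1 = 0 := by
  have : (t - 1) * (t ^ 2 + t + 1) = 0 := by linear_combination h
  rcases mul_eq_zero.1 this with h | h
  · exact Or.inl (sub_eq_zero.1 h)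
  · exact Or.inr h

/-- The three terms of the cyclic sum coincide: it is three times a cube root of unity. -/
theorem normSq_sum_of_same_cubeRoot {p q : Fin 3 → ℂ} (hp : ∀ j, p j * conj (p j) = 1)
    (hq : ∀ j, q j * conj (q j) = 1) {ζ r s : ℂ} (hζ : ζ ^ 2 + ζ + 1 = 0) (hr : r ^ 3 = 1)
    (hs : s ^ 3 = 1)
    (p0 : p 0 * conj (p 1) = r) (p1 : p 1 * conj (p 2) = ζ * r) (p2 : p 2 * conj (p 0) = ζ ^ 2 * r)
    (q0 : q 0 * conj (q 1) = s) (q1 : q 1 * conj (q 2) = ζ * s)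
    (q2 : q 2 * conj (q 0) = ζ ^ 2 * s) :
    ‖∑ j, conj (q j) * p j‖ ^ 2 = 0 ∨ ‖∑ j, conj (q j) * p j‖ ^ 2 = 9 := by
  have hz3 : ζ ^ 3 = 1 := by linear_combination (ζ - 1) * hζ
  have hc : cyclicSum p q = 3 * (r * conj s) := by
    simp only [cyclicSum, p0, p1, p2, q0, q1, q2, map_mul, map_pow, conj_cubeRoot hζ]
    linear_combination (r * conj s) * (ζ ^ 3 + 2) * hz3
  rw [normSq_sum_conj_mul hp hq, hc]
  have ht : (r * conj s) ^ 3 = 1 := by rw [mul_pow, ← map_pow, hr, hs]; simp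
  rcases cube_eq_one_cases ht with h | h
  · right; rw [h]; norm_num
  · left; have := re_cubeRoot h
    rw [show (3 : ℂ) * (r * conj s) = ((3 : ℝ) : ℂ) * (r * conj s) by norm_num,
      Complex.re_ofReal_mul, this]
    norm_num

/-- The terms of the cyclic sum are `r * conj s` times the three distinct cube roots of unity, and
cancel. -/
theorem normSq_sum_of_distinct_cubeRoot {p q : Fin 3 → ℂ} (hp : ∀ j, p j * conj (p j) = 1)
    (hq : ∀ j, q j * conj (q j) = 1) {ζ r s : ℂ} (hζ : ζ ^ 2 + ζ + 1 = 0)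
    (p0 : p 0 * conj (p 1) = r) (p1 : p 1 * conj (p 2) = ζ * r) (p2 : p 2 * conj (p 0) = ζ ^ 2 * r)
    (q0 : q 0 * conj (q 1) = s) (q1 : q 1 * conj (q 2) = ζ ^ 2 * s)
    (q2 : q 2 * conj (q 0) = (ζ ^ 2) ^ 2 * s) :
    ‖∑ j, conj (q j) * p j‖ ^ 2 = 3 := by
  have hc : cyclicSum p q = 0 := by
    simp only [cyclicSum, p0, p1, p2, q0, q1, q2, map_mul, map_pow, conj_cubeRoot hζ]
    have hz3 : ζ ^ 3 = 1 := by linear_combination (ζ - 1) * hζ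
    linear_combination (r * conj s) * (ζ ^ 2 + ζ ^ 7 + ζ ^ 4 + ζ) * hz3 + (r * conj s) * hζ
  rw [normSq_sum_conj_mul hp hq, hc]; simp

/-! ### Vectors unbiased to a mutually unbiased pair of bases of ℂ³. -/

section Qutrit

/-- The vector `p` of `ℂ³` is unbiased to the orthonormal basis `A`. -/
def UnbiasedTo (A : OrthonormalBasis (Fin 3) ℂ (EuclideanSpace ℂ (Fin 3)))
    (p : EuclideanSpace ℂ (Fin 3)) : Prop :=
  ∀ j, ‖⟪A j, p⟫_ℂ‖ ^ 2 = 1 / 3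

/-- The coordinates of `p` in the basis `A`, scaled and dephased by those of `u`. -/
noncomputable def dephased (A : OrthonormalBasis (Fin 3) ℂ (EuclideanSpace ℂ (Fin 3)))
    (u p : EuclideanSpace ℂ (Fin 3)) (j : Fin 3) : ℂ :=
  3 * (⟪A j, p⟫_ℂ * conj ⟪A j, u⟫_ℂ)

variable {A B : OrthonormalBasis (Fin 3) ℂ (EuclideanSpace ℂ (Fin 3))}
  {u p q : EuclideanSpace ℂ (Fin 3)}

theorem dephased_mul_conj (hu : UnbiasedTo A u) (hp : UnbiasedTo A p) (j : Fin 3) :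
    dephased A u p j * conj (dephased A u p j) = 1 := by
  rw [Complex.mul_conj']
  have h : ‖dephased A u p j‖ ^ 2 = 1 := by
    rw [dephased, norm_mul, norm_mul, RCLike.norm_conj, mul_pow, mul_pow, hu j, hp j]
    norm_num
  exact_mod_cast h

theorem sum_dephased : ∑ j, dephased A u p j = 3 * ⟪u, p⟫_ℂ := by
  rw [← A.sum_inner_mul_inner u p, Finset.mul_sum]
  refine Finset.sum_congr rfl fun j _ => ?_
  rw [dephased, inner_conj_symm]; ring

theorem sum_conj_dephased_mul (hu : UnbiasedTo A u) :
    ∑ j, conj (dephased A u q j) * dephased A u p j = 3 * ⟪q, p⟫_ℂ := by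
  rw [← A.sum_inner_mul_inner q p, Finset.mul_sum]
  refine Finset.sum_congr rfl fun j _ => ?_
  have h : ⟪A j, u⟫_ℂ * conj ⟪A j, u⟫_ℂ = 1 / 3 := by
    rw [Complex.mul_conj', ← Complex.ofReal_pow, hu j]; norm_num
  rw [dephased, dephased, ← inner_conj_symm q (A j)]
  simp only [map_mul, Complex.conj_conj, map_ofNat]
  linear_combination 9 * conj ⟪A j, q⟫_ℂ * ⟪A j, p⟫_ℂ * h

theorem norm_three_mul_sq (z : ℂ) : ‖3 * z‖ ^ 2 = 9 * ‖z‖ ^ 2 := by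
  rw [norm_mul, mul_pow]; norm_num

/-- Dephasing turns `B 0` into the all-ones vector and `B 1` into a unimodular vector of zero sum;
these two members of `B` suffice. -/
theorem cyclicSum_dephased (hB : ∀ k, UnbiasedTo A (B k)) (hp : UnbiasedTo A p)
    (h : UnbiasedTo B p) : cyclicSum (dephased A (B 0) p) 1 = 0 := by
  refine cyclicSum_eq_zero_of_unbiased (h := dephased A (B 0) (B 1))
    (dephased_mul_conj (hB 0) hp) (dephased_mul_conj (hB 0) (hB 1)) ?_ ?_ ?_
  · rw [sum_dephased, B.inner_eq_zero (by decide), mul_zero]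
  · rw [sum_dephased, norm_three_mul_sq, h 0]; norm_num
  · rw [sum_conj_dephased_mul (hB 0), norm_three_mul_sq, h 1]; norm_num

theorem unbiasedTo_of_cyclicSum (hB : ∀ k, UnbiasedTo A (B k)) (hp : UnbiasedTo A p)
    (h : cyclicSum (dephased A (B 0) p) 1 = 0) : UnbiasedTo B p := by
  have hP := dephased_mul_conj (hB 0) hp
  intro k
  have h9 : 9 * ‖⟪B k, p⟫_ℂ‖ ^ 2 = 3 := by
    by_cases hk : k = 0
    · subst hk
      rw [← unbiased_one_of_cyclicSum_eq_zero hP h, sum_dephased, norm_three_mul_sq]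
    · rw [← unbiased_of_cyclicSum_eq_zero hP (dephased_mul_conj (hB 0) (hB k)) ?_ h,
        sum_conj_dephased_mul (hB 0), norm_three_mul_sq]
      rw [sum_dephased, B.inner_eq_zero (Ne.symm hk), mul_zero]
  linarith

/-- A vector unbiased to `A` and orthogonal to a vector unbiased to both `A` and `B` is unbiased
to `B`. -/
theorem UnbiasedTo.of_orthogonal (hB : ∀ k, UnbiasedTo A (B k)) {w : EuclideanSpace ℂ (Fin 3)}
    (hw : UnbiasedTo A w) (hw' : UnbiasedTo B w) (hp : UnbiasedTo A p) (h : ⟪w, p⟫_ℂ = 0) :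
    UnbiasedTo B p := by
  refine unbiasedTo_of_cyclicSum hB hp
    (cyclicSum_eq_zero_of_orthogonal (dephased_mul_conj (hB 0) hp) (dephased_mul_conj (hB 0) hw) ?_
      (cyclicSum_dephased hB hw hw'))
  rw [sum_conj_dephased_mul (hB 0), h, mul_zero]

/-- The vectors unbiased to two mutually unbiased bases of `ℂ³` fall into two classes: those of the
same class are parallel or orthogonal, those of different classes are unbiased. -/
theorem exists_class (hB : ∀ k, UnbiasedTo A (B k)) :
    ∃ par : EuclideanSpace ℂ (Fin 3) → Prop, ∀ p q, UnbiasedTo A p → UnbiasedTo B p →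
      UnbiasedTo A q → UnbiasedTo B q →
        ((par p ↔ par q) → ‖⟪p, q⟫_ℂ‖ ^ 2 = 0 ∨ ‖⟪p, q⟫_ℂ‖ ^ 2 = 1) ∧
        (¬ (par p ↔ par q) → ‖⟪p, q⟫_ℂ‖ ^ 2 = 1 / 3) := by
  obtain ⟨ω, hω⟩ : ∃ ω : ℂ, ω ^ 2 + ω + 1 = 0 := by
    obtain ⟨z, hz⟩ := IsAlgClosed.exists_root (Polynomial.X ^ 2 + Polynomial.X + 1 : Polynomial ℂ)
      (by rw [show (Polynomial.X ^ 2 + Polynomial.X + 1 : Polynomial ℂ).degree = 2 by compute_degree!]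
          norm_num)
    exact ⟨z, by simpa using hz⟩
  have hω3 : ω ^ 3 = 1 := by linear_combination (ω - 1) * hω
  have hne : ω ≠ ω ^ 2 := by
    intro h
    have h0 : ω - ω ^ 2 = 0 := sub_eq_zero.2 h
    have : (3 : ℂ) = 0 := by linear_combination 4 * hω - (2 * ω + 1) * (hω + h0)
    norm_num at this
  let D := dephased A (B 0)
  -- The class records which primitive cube root, `ω` or `ω ^ 2`, governs the phase differences.
  refine ⟨fun p => D p 1 * conj (D p 2) = ω * (D p 0 * conj (D p 1)), fun p q hpA hpB hqA hqB => ?_⟩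
  have hP := dephased_mul_conj (hB 0) hpA
  have hQ := dephased_mul_conj (hB 0) hqA
  obtain ⟨ζ, r, hζ, hr, p0, p1, p2⟩ :=
    exists_cubeRoot_of_cyclicSum_eq_zero hP (cyclicSum_dephased hB hpA hpB)
  obtain ⟨ξ, s, hξ, hs, q0, q1, q2⟩ :=
    exists_cubeRoot_of_cyclicSum_eq_zero hQ (cyclicSum_dephased hB hqA hqB)
  have hr0 : r ≠ 0 := by rintro rfl; simp at hr
  have hs0 : s ≠ 0 := by rintro rfl; simp at hs
  have e : ‖⟪p, q⟫_ℂ‖ ^ 2 = ‖∑ j, conj (D q j) * D p j‖ ^ 2 / 9 := by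
    rw [sum_conj_dephased_mul (hB 0), norm_three_mul_sq, norm_inner_symm]; ring
  have c1 : (D p 1 * conj (D p 2) = ω * (D p 0 * conj (D p 1))) ↔ ζ = ω := by
    rw [p0, p1]; exact mul_left_inj' hr0
  have c2 : (D q 1 * conj (D q 2) = ω * (D q 0 * conj (D q 1))) ↔ ξ = ω := by
    rw [q0, q1]; exact mul_left_inj' hs0
  beta_reduce
  rw [c1, c2, e]
  have same : ζ = ξ → ‖∑ j, conj (D q j) * D p j‖ ^ 2 / 9 = 0 ∨
      ‖∑ j, conj (D q j) * D p j‖ ^ 2 / 9 = 1 := by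
    rintro rfl
    rcases normSq_sum_of_same_cubeRoot hP hQ hζ hr hs p0 p1 p2 q0 q1 q2 with h | h
    · left; rw [h]; norm_num
    · right; rw [h]; norm_num
  have diff : ξ = ζ ^ 2 → ‖∑ j, conj (D q j) * D p j‖ ^ 2 / 9 = 1 / 3 := by
    rintro rfl
    rw [normSq_sum_of_distinct_cubeRoot hP hQ hζ p0 p1 p2 q0 q1 q2]; norm_num
  have h4 : (ω ^ 2) ^ 2 = ω := by linear_combination ω * hω3
  rcases eq_of_cubeRoot hω hζ with h1 | h1 <;> rcases eq_of_cubeRoot hω hξ with h2 | h2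
  · exact ⟨fun _ => same (h1.trans h2.symm), fun h => (h (by simp [h1, h2])).elim⟩
  · exact ⟨fun h => (hne ((h.1 h1).symm.trans h2)).elim, fun _ => diff (by rw [h1, h2])⟩
  · exact ⟨fun h => (hne ((h.2 h2).symm.trans h1)).elim, fun _ => diff (by rw [h1, h2, h4])⟩
  · exact ⟨fun _ => same (h1.trans h2.symm), fun h => (h (by simp [h1, h2])).elim⟩

theorem UnbiasedTo.overlap (hB : ∀ k, UnbiasedTo A (B k)) (hpA : UnbiasedTo A p)
    (hpB : UnbiasedTo B p) (hqA : UnbiasedTo A q) (hqB : UnbiasedTo B q) :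
    ‖⟪p, q⟫_ℂ‖ ^ 2 = 0 ∨ ‖⟪p, q⟫_ℂ‖ ^ 2 = 1 ∨ ‖⟪p, q⟫_ℂ‖ ^ 2 = 1 / 3 := by
  obtain ⟨par, h⟩ := exists_class hB
  obtain ⟨h1, h2⟩ := h p q hpA hpB hqA hqB
  by_cases hc : par p ↔ par q
  · rcases h1 hc with h | h <;> simp [h]
  · exact Or.inr (Or.inr (h2 hc))

theorem not_three_unbiased (hB : ∀ k, UnbiasedTo A (B k)) {t : EuclideanSpace ℂ (Fin 3)}
    (hpA : UnbiasedTo A p) (hpB : UnbiasedTo B p) (hqA : UnbiasedTo A q) (hqB : UnbiasedTo B q)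
    (htA : UnbiasedTo A t) (htB : UnbiasedTo B t) (hpq : ‖⟪p, q⟫_ℂ‖ ^ 2 = 1 / 3)
    (hqt : ‖⟪q, t⟫_ℂ‖ ^ 2 = 1 / 3) (hpt : ‖⟪p, t⟫_ℂ‖ ^ 2 = 1 / 3) : False := by
  obtain ⟨par, h⟩ := exists_class hB
  have h1 := (h p q hpA hpB hqA hqB).1
  have h2 := (h q t hqA hqB htA htB).1
  have h3 := (h p t hpA hpB htA htB).1
  rw [hpq] at h1
  rw [hqt] at h2
  rw [hpt] at h3
  norm_num at h1 h2 h3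
  tauto

theorem UnbiasedTo.symm (hB : ∀ k, UnbiasedTo A (B k)) (j : Fin 3) : UnbiasedTo B (A j) := by
  intro k; rw [norm_inner_symm]; exact hB k j

/-- Two bases unbiased to a mutually unbiased pair either are unbiased to each other or consist of
the same states. -/
theorem unbiased_or_same (hB : ∀ k, UnbiasedTo A (B k))
    {C C' : OrthonormalBasis (Fin 3) ℂ (EuclideanSpace ℂ (Fin 3))}
    (hA : ∀ j, UnbiasedTo A (C j)) (hA' : ∀ j, UnbiasedTo A (C' j))
    (hBC : ∀ j, UnbiasedTo B (C j)) (hBC' : ∀ j, UnbiasedTo B (C' j)) :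
    (∀ j, UnbiasedTo C (C' j)) ∨ (∀ p, UnbiasedTo C' p → UnbiasedTo C p) := by
  obtain ⟨par, h⟩ := exists_class hB
  -- Orthogonal vectors do not overlap in 1/3, so a basis lies in one class.
  have hC : ∀ j, par (C j) ↔ par (C 0) := by
    intro j
    by_contra hne
    have h1 := (h (C j) (C 0) (hA j) (hBC j) (hA 0) (hBC 0)).2 hne
    rcases eq_or_ne j 0 with rfl | hj
    · exact hne Iff.rfl
    · rw [C.inner_eq_zero hj] at h1; norm_num at h1
  have hC' : ∀ j, par (C' j) ↔ par (C' 0) := by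
    intro j
    by_contra hne
    have h1 := (h (C' j) (C' 0) (hA' j) (hBC' j) (hA' 0) (hBC' 0)).2 hne
    rcases eq_or_ne j 0 with rfl | hj
    · exact hne Iff.rfl
    · rw [C'.inner_eq_zero hj] at h1; norm_num at h1
  by_cases hc : par (C 0) ↔ par (C' 0)
  · right
    intro p hp j
    have h01 : ∀ k, ‖⟪C' k, C j⟫_ℂ‖ ^ 2 = 0 ∨ ‖⟪C' k, C j⟫_ℂ‖ ^ 2 = 1 := fun k =>
      (h (C' k) (C j) (hA' k) (hBC' k) (hA j) (hBC j)).1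
        ((hC' k).trans (hc.symm.trans (hC j).symm))
    have hsum := C'.sum_sq_norm_inner_right (C j)
    rw [C.orthonormal.1 j] at hsum
    -- Overlaps in {0, 1} summing to 1: `C j` is a member of `C'` up to a phase.
    obtain ⟨k, hk⟩ : ∃ k, ‖⟪C' k, C j⟫_ℂ‖ ^ 2 = 1 := by
      by_contra! hn
      rw [Finset.sum_eq_zero fun k _ => (h01 k).resolve_right (hn k)] at hsum
      norm_num at hsum
    have hz : ∀ l ≠ k, ⟪C' l, C j⟫_ℂ = 0 := by
      intro l hl
      rw [← Finset.add_sum_erase _ _ (Finset.mem_univ k), hk] at hsum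
      have h0 := (Finset.sum_eq_zero_iff_of_nonneg (fun i _ => by positivity)).1
        (show ∑ i ∈ Finset.univ.erase k, ‖⟪C' i, C j⟫_ℂ‖ ^ 2 = 0 by linarith) l
        (Finset.mem_erase.2 ⟨hl, Finset.mem_univ _⟩)
      simpa using h0
    rw [← C'.sum_inner_mul_inner, Finset.sum_eq_single k, norm_mul, mul_pow, hp k,
      norm_inner_symm, hk, one_mul]
    · intro l _ hl
      rw [← inner_conj_symm, hz l hl]; simp
    · simp
  · left
    intro j k
    exact (h (C k) (C' j) (hA k) (hBC k) (hA' j) (hBC' j)).2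
      (fun hh => hc ((hC k).symm.trans (hh.trans (hC' j))))

end Qutrit

/-! ### Planar geometry and the Bloch sphere. -/

theorem normSq_add (s t : ℂ) : ‖s + t‖ ^ 2 = ‖s‖ ^ 2 + ‖t‖ ^ 2 + 2 * (conj s * t).re := by
  simp only [Complex.sq_norm, Complex.normSq_apply, Complex.add_re, Complex.add_im, Complex.mul_re,
    Complex.conj_re, Complex.conj_im]
  ring

/-- As plane vectors of length 1/2, `v` and `w` lie on the line orthogonal to `u`. -/
theorem re_sq_of_orthogonal {u v w : ℂ} (hu : ‖u‖ ^ 2 = 1 / 4) (hv : ‖v‖ ^ 2 = 1 / 4)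
    (hw : ‖w‖ ^ 2 = 1 / 4) (h1 : (conj u * v).re = 0) (h2 : (conj u * w).re = 0) :
    (conj v * w).re ^ 2 = 1 / 16 := by
  simp only [Complex.sq_norm, Complex.normSq_apply] at hu hv hw
  simp only [Complex.mul_re, Complex.conj_re, Complex.conj_im] at h1 h2 ⊢
  have h3 : (u.re * v.im - u.im * v.re) ^ 2 = 1 / 16 := by
    linear_combination (-u.re * v.re - u.im * v.im) * h1 + hu * (v.re * v.re + v.im * v.im)
      + 1 / 4 * hv
  have h4 : (u.re * w.im - u.im * w.re) ^ 2 = 1 / 16 := by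
    linear_combination (-u.re * w.re - u.im * w.im) * h2 + hu * (w.re * w.re + w.im * w.im)
      + 1 / 4 * hw
  have h5 : v.re * w.re - -v.im * w.im
      = 4 * ((u.re * v.im - u.im * v.re) * (u.re * w.im - u.im * w.re)) := by
    linear_combination -4 * (v.re * w.re + v.im * w.im) * hu
      + 4 * (u.re * w.re + u.im * w.im) * h1
  rw [h5, mul_pow, mul_pow, h3, h4]; norm_num

theorem eq_zero_of_re_mul_orthogonal {g h t : ℂ} (hg : g ≠ 0) (hh : h ≠ 0)
    (hgh : (conj g * h).re = 0) (h1 : (g * t).re = 0) (h2 : (h * t).re = 0) : t = 0 := by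
  have e : ((g * t).im * (h * t).im : ℝ) = 0 := by
    have : conj (g * t) * (h * t) = (Complex.normSq t : ℂ) * (conj g * h) := by
      rw [map_mul, ← Complex.mul_conj]; ring
    have := congrArg Complex.re this
    rw [Complex.re_ofReal_mul, hgh, Complex.mul_re, Complex.conj_re, Complex.conj_im, h1] at this
    linarith
  rcases mul_eq_zero.1 e with e | e
  · exact (mul_eq_zero.1 (Complex.ext h1 e : g * t = 0)).resolve_left hg
  · exact (mul_eq_zero.1 (Complex.ext h2 e : h * t = 0)).resolve_left hh

theorem exists_basis_qubit {x : EuclideanSpace ℂ (Fin 2)} (hx : ‖x‖ = 1) :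
    ∃ α : OrthonormalBasis (Fin 2) ℂ (EuclideanSpace ℂ (Fin 2)), α 0 = x := by
  -- Only index 0 is prescribed; the constant family is filler elsewhere.
  obtain ⟨b, hb⟩ := Orthonormal.exists_orthonormalBasis_extension_of_card_eq (𝕜 := ℂ)
    (v := fun _ : Fin 2 => x) (s := {0}) (by simp)
    (by
      refine ⟨fun _ => hx, fun i j hij => (hij ?_).elim⟩
      exact Subtype.ext (i.2.trans j.2.symm))
  exact ⟨b, hb 0 rfl⟩

section Qubit

variable {α : OrthonormalBasis (Fin 2) ℂ (EuclideanSpace ℂ (Fin 2))}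
  {x y c : EuclideanSpace ℂ (Fin 2)}

theorem normSq_qubit (α : OrthonormalBasis (Fin 2) ℂ (EuclideanSpace ℂ (Fin 2)))
    (x : EuclideanSpace ℂ (Fin 2)) :
    ‖⟪α 0, x⟫_ℂ‖ ^ 2 + ‖⟪α 1, x⟫_ℂ‖ ^ 2 = ‖x‖ ^ 2 := by
  rw [← α.sum_sq_norm_inner_right x, Fin.sum_univ_two]

/-- The off-diagonal entry of the projector onto `x` in the basis `α`. -/
noncomputable def coherence (α : OrthonormalBasis (Fin 2) ℂ (EuclideanSpace ℂ (Fin 2)))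
    (x : EuclideanSpace ℂ (Fin 2)) : ℂ :=
  conj ⟪α 0, x⟫_ℂ * ⟪α 1, x⟫_ℂ

theorem normSq_coherence (h : ∀ i, ‖⟪α i, x⟫_ℂ‖ ^ 2 = 1 / 2) :
    ‖coherence α x‖ ^ 2 = 1 / 4 := by
  rw [coherence, norm_mul, RCLike.norm_conj, mul_pow, h, h]; norm_num

/-- Both states lie on the equator relative to `α`; the coherences are their equatorial vectors,
which are orthogonal exactly when the states are unbiased. -/
theorem normSq_inner_qubit (hx : ∀ i, ‖⟪α i, x⟫_ℂ‖ ^ 2 = 1 / 2)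
    (hy : ∀ i, ‖⟪α i, y⟫_ℂ‖ ^ 2 = 1 / 2) :
    ‖⟪x, y⟫_ℂ‖ ^ 2 = 1 / 2 + 2 * (conj (coherence α x) * coherence α y).re := by
  rw [← α.sum_inner_mul_inner x y, Fin.sum_univ_two, normSq_add, norm_mul, norm_mul, mul_pow,
    mul_pow, norm_inner_symm x, norm_inner_symm x, hx, hx, hy, hy]
  have : conj (⟪x, α 0⟫_ℂ * ⟪α 0, y⟫_ℂ) * (⟪x, α 1⟫_ℂ * ⟪α 1, y⟫_ℂ)
      = conj (coherence α x) * coherence α y := by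
    simp only [coherence, map_mul, inner_conj_symm]
    ring
  rw [this]; norm_num

theorem unbiased_both (hx : ‖x‖ = 1) (h : ‖⟪α 0, x⟫_ℂ‖ ^ 2 = 1 / 2) (i : Fin 2) :
    ‖⟪α i, x⟫_ℂ‖ ^ 2 = 1 / 2 := by
  have := normSq_qubit α x
  rw [hx] at this
  fin_cases i
  · exact h
  · change ‖⟪α 1, x⟫_ℂ‖ ^ 2 = 1 / 2
    linarith

theorem re_coherence_eq_zero (hx : ∀ i, ‖⟪α i, x⟫_ℂ‖ ^ 2 = 1 / 2)
    (hy : ∀ i, ‖⟪α i, y⟫_ℂ‖ ^ 2 = 1 / 2) (h : ‖⟪x, y⟫_ℂ‖ ^ 2 = 1 / 2) :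
    (conj (coherence α x) * coherence α y).re = 0 := by
  have := normSq_inner_qubit hx hy
  linarith

/-- Two states unbiased to a mutually unbiased pair of qubit states are parallel or orthogonal. -/
theorem qubit_overlap {b : EuclideanSpace ℂ (Fin 2)} (hb : ‖b‖ = 1) (hc : ‖c‖ = 1) (hx : ‖x‖ = 1)
    (hy : ‖y‖ = 1) (hbc : ‖⟪b, c⟫_ℂ‖ ^ 2 = 1 / 2) (hbx : ‖⟪b, x⟫_ℂ‖ ^ 2 = 1 / 2)
    (hby : ‖⟪b, y⟫_ℂ‖ ^ 2 = 1 / 2) (hcx : ‖⟪c, x⟫_ℂ‖ ^ 2 = 1 / 2)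
    (hcy : ‖⟪c, y⟫_ℂ‖ ^ 2 = 1 / 2) : ‖⟪x, y⟫_ℂ‖ ^ 2 = 0 ∨ ‖⟪x, y⟫_ℂ‖ ^ 2 = 1 := by
  obtain ⟨β, rfl⟩ := exists_basis_qubit hb
  have uc := unbiased_both hc hbc
  have ux := unbiased_both hx hbx
  have uy := unbiased_both hy hby
  have h := re_sq_of_orthogonal (normSq_coherence uc) (normSq_coherence ux) (normSq_coherence uy)
    (re_coherence_eq_zero uc ux hcx) (re_coherence_eq_zero uc uy hcy)
  rw [normSq_inner_qubit ux uy]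
  have : ((conj (coherence β x) * coherence β y).re - 1 / 4)
      * ((conj (coherence β x) * coherence β y).re + 1 / 4) = 0 := by
    linear_combination h
  rcases mul_eq_zero.1 this with h | h
  · right; linarith
  · left; linarith

end Qubit

/-! ### Contraction with qubit vectors. -/

/-- The partial inner product of a vector of `ℂ² ⊗ ℂ³` with a vector of `ℂ²`. -/
noncomputable def contract (φ : EuclideanSpace ℂ (Fin 2)) :
    QubitQutrit →ₗ[ℂ] EuclideanSpace ℂ (Fin 3) :=
  TensorProduct.lift ((LinearMap.lsmul ℂ (EuclideanSpace ℂ (Fin 3))).comp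
    (innerSL ℂ φ).toLinearMap)

theorem contract_tmul (φ ψ : EuclideanSpace ℂ (Fin 2)) (Ψ : EuclideanSpace ℂ (Fin 3)) :
    contract φ (ψ ⊗ₜ Ψ) = ⟪φ, ψ⟫_ℂ • Ψ := by
  simp [contract]

theorem inner_contract (φ : EuclideanSpace ℂ (Fin 2)) (Φ : EuclideanSpace ℂ (Fin 3))
    (v : QubitQutrit) : ⟪Φ, contract φ v⟫_ℂ = ⟪φ ⊗ₜ[ℂ] Φ, v⟫_ℂ := by
  induction v using TensorProduct.induction_on with
  | zero => simp
  | tmul ψ Ψ => rw [contract_tmul, inner_smul_right, TensorProduct.inner_tmul]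
  | add v w hv hw => rw [map_add, inner_add_right, inner_add_right, hv, hw]

theorem contract_eq_sum (α : OrthonormalBasis (Fin 2) ℂ (EuclideanSpace ℂ (Fin 2)))
    (φ : EuclideanSpace ℂ (Fin 2)) (v : QubitQutrit) :
    contract φ v = ⟪φ, α 0⟫_ℂ • contract (α 0) v + ⟪φ, α 1⟫_ℂ • contract (α 1) v := by
  refine ext_inner_left ℂ fun Φ => ?_
  conv_lhs => rw [inner_contract, ← α.sum_repr' φ, Fin.sum_univ_two]
  rw [TensorProduct.add_tmul, inner_add_left, TensorProduct.smul_tmul, TensorProduct.smul_tmul,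
    ← inner_contract, ← inner_contract, inner_smul_left, inner_smul_left, inner_add_right,
    inner_smul_right, inner_smul_right, inner_conj_symm, inner_conj_symm]

theorem eq_sum_tmul_contract (α : OrthonormalBasis (Fin 2) ℂ (EuclideanSpace ℂ (Fin 2)))
    (v : QubitQutrit) :
    v = α 0 ⊗ₜ[ℂ] contract (α 0) v + α 1 ⊗ₜ[ℂ] contract (α 1) v := by
  induction v using TensorProduct.induction_on with
  | zero => simp
  | tmul ψ Ψ =>
    conv_lhs => rw [← α.sum_repr' ψ, Fin.sum_univ_two]
    rw [contract_tmul, contract_tmul, TensorProduct.add_tmul, TensorProduct.smul_tmul,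
      TensorProduct.smul_tmul]
  | add v w hv hw =>
    conv_lhs => rw [hv, hw]
    simp only [map_add, TensorProduct.tmul_add]
    abel

theorem normSq_inner_tmul (φ ψ : EuclideanSpace ℂ (Fin 2)) (Φ Ψ : EuclideanSpace ℂ (Fin 3)) :
    ‖⟪φ ⊗ₜ[ℂ] Φ, ψ ⊗ₜ[ℂ] Ψ⟫_ℂ‖ ^ 2 = ‖⟪φ, ψ⟫_ℂ‖ ^ 2 * ‖⟪Φ, Ψ⟫_ℂ‖ ^ 2 := by
  rw [TensorProduct.inner_tmul, norm_mul, mul_pow]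

theorem norm_contract_add (α : OrthonormalBasis (Fin 2) ℂ (EuclideanSpace ℂ (Fin 2)))
    (v : QubitQutrit) : ‖contract (α 0) v‖ ^ 2 + ‖contract (α 1) v‖ ^ 2 = ‖v‖ ^ 2 := by
  have h : ⟪v, v⟫_ℂ = ⟪contract (α 0) v, contract (α 0) v⟫_ℂ
      + ⟪contract (α 1) v, contract (α 1) v⟫_ℂ := by
    conv_lhs => arg 2; rw [eq_sum_tmul_contract α v]
    rw [inner_add_left, ← inner_contract, ← inner_contract]
  have hv := inner_self_eq_norm_sq_to_K (𝕜 := ℂ) v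
  rw [h, inner_self_eq_norm_sq_to_K, inner_self_eq_norm_sq_to_K] at hv
  exact_mod_cast hv

/-! ### Factorwise unbiasedness to a product basis. -/

section ProductBasis

variable {b : OrthonormalBasis (Fin 6) ℂ QubitQutrit} {φ : Fin 6 → EuclideanSpace ℂ (Fin 2)}
  {Φ : Fin 6 → EuclideanSpace ℂ (Fin 3)}

/-- This is the partial trace over the qutrit of the resolution of the identity by `b`. -/
theorem sum_normSq_qubit (hb : ∀ k, b k = φ k ⊗ₜ[ℂ] Φ k) (hΦ : ∀ k, ‖Φ k‖ = 1)
    (x : EuclideanSpace ℂ (Fin 2)) : ∑ k, ‖⟪φ k, x⟫_ℂ‖ ^ 2 = 3 * ‖x‖ ^ 2 := by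
  let e := EuclideanSpace.basisFun (Fin 3) ℂ
  calc ∑ k, ‖⟪φ k, x⟫_ℂ‖ ^ 2 = ∑ k, ∑ j, ‖⟪b k, x ⊗ₜ[ℂ] e j⟫_ℂ‖ ^ 2 := by
        refine Finset.sum_congr rfl fun k _ => ?_
        simp only [hb, normSq_inner_tmul, ← Finset.mul_sum, e.sum_sq_norm_inner_left, hΦ]
        ring
    _ = ∑ j : Fin 3, ‖(x ⊗ₜ[ℂ] e j : QubitQutrit)‖ ^ 2 := by
        rw [Finset.sum_comm]
        exact Finset.sum_congr rfl fun j _ => b.sum_sq_norm_inner_right _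
    _ = 3 * ‖x‖ ^ 2 := by simp [e.orthonormal.1]

theorem sum_normSq_qutrit (hb : ∀ k, b k = φ k ⊗ₜ[ℂ] Φ k) (hφ : ∀ k, ‖φ k‖ = 1)
    (x : EuclideanSpace ℂ (Fin 3)) : ∑ k, ‖⟪Φ k, x⟫_ℂ‖ ^ 2 = 2 * ‖x‖ ^ 2 := by
  let e := EuclideanSpace.basisFun (Fin 2) ℂ
  calc ∑ k, ‖⟪Φ k, x⟫_ℂ‖ ^ 2 = ∑ k, ∑ j, ‖⟪b k, e j ⊗ₜ[ℂ] x⟫_ℂ‖ ^ 2 := by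
        refine Finset.sum_congr rfl fun k _ => ?_
        simp only [hb, normSq_inner_tmul, ← Finset.sum_mul, e.sum_sq_norm_inner_left, hφ]
        ring
    _ = ∑ j : Fin 2, ‖(e j ⊗ₜ[ℂ] x : QubitQutrit)‖ ^ 2 := by
        rw [Finset.sum_comm]
        exact Finset.sum_congr rfl fun j _ => b.sum_sq_norm_inner_right _
    _ = 2 * ‖x‖ ^ 2 := by simp [e.orthonormal.1]

/-- A product state unbiased to a product basis is unbiased to its qubit factors. -/
theorem qubit_unbiased (hb : ∀ k, b k = φ k ⊗ₜ[ℂ] Φ k) (hφ : ∀ k, ‖φ k‖ = 1)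
    (hΦ : ∀ k, ‖Φ k‖ = 1) {ψ : EuclideanSpace ℂ (Fin 2)} {Ψ : EuclideanSpace ℂ (Fin 3)}
    (hψ : ‖ψ‖ = 1) (hΨ : ‖Ψ‖ = 1) (h : ∀ k, ‖⟪b k, ψ ⊗ₜ[ℂ] Ψ⟫_ℂ‖ ^ 2 = 1 / 6) (k : Fin 6) :
    ‖⟪φ k, ψ⟫_ℂ‖ ^ 2 = 1 / 2 := by
  have h1 := sum_normSq_qubit hb hΦ ψ
  have h2 := sum_normSq_qutrit hb hφ Ψ
  rw [hψ] at h1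
  rw [hΨ] at h2
  have h3 : ∀ k, ‖⟪φ k, ψ⟫_ℂ‖ ^ 2 * ‖⟪Φ k, Ψ⟫_ℂ‖ ^ 2 = 1 / 6 := fun k => by
    rw [← normSq_inner_tmul, ← hb, h]
  generalize hp : (fun k => ‖⟪φ k, ψ⟫_ℂ‖ ^ 2) = p at *
  generalize hq : (fun k => ‖⟪Φ k, Ψ⟫_ℂ‖ ^ 2) = q at *
  have hp' : ∀ k, ‖⟪φ k, ψ⟫_ℂ‖ ^ 2 = p k := fun k => congrFun hp k
  have hq' : ∀ k, ‖⟪Φ k, Ψ⟫_ℂ‖ ^ 2 = q k := fun k => congrFun hq k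
  have hp0 : ∀ k, 0 ≤ p k := fun k => hp' k ▸ by positivity
  simp only [hp', hq'] at h1 h2 h3 ⊢
  have hpos : ∀ k, 0 < p k := fun k =>
    lt_of_le_of_ne (hp0 k) (by rintro hk; have := h3 k; rw [← hk] at this; norm_num at this)
  -- Since `6 * q k = 1 / p k`, this is the AM-GM deficit; it sums to 4·3 - 24 + 6·2 = 0.
  have hterm : ∀ k, 4 * p k - 4 + 6 * q k = (2 * p k - 1) ^ 2 / p k := by
    intro k
    have := hpos k
    field_simp
    linear_combination 6 * h3 k
  have hsum : ∑ k, (2 * p k - 1) ^ 2 / p k = 0 := by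
    simp only [← hterm, Finset.sum_add_distrib, Finset.sum_sub_distrib, ← Finset.mul_sum, h1, h2]
    norm_num
  have := (Finset.sum_eq_zero_iff_of_nonneg
    (fun k _ => div_nonneg (sq_nonneg _) (hp0 k))).1 hsum k (Finset.mem_univ k)
  rw [div_eq_zero_iff, or_iff_left (hpos k).ne', sq_eq_zero_iff] at this
  linarith

end ProductBasis

/-! ### Split product bases and vectors unbiased to three of them. -/

section Splits

/-- The product basis `b` consists, up to order, of the vectors `α i ⊗ A i j`. -/
def Splits (b : OrthonormalBasis (Fin 6) ℂ QubitQutrit)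
    (α : OrthonormalBasis (Fin 2) ℂ (EuclideanSpace ℂ (Fin 2)))
    (A : Fin 2 → OrthonormalBasis (Fin 3) ℂ (EuclideanSpace ℂ (Fin 3))) : Prop :=
  ∀ i j, ∃ k, b k = α i ⊗ₜ[ℂ] A i j

/-- All members of the pairs `(α, A)` and `(β, B)` of families of bases are unbiased. -/
def SplitUnbiased (α β : OrthonormalBasis (Fin 2) ℂ (EuclideanSpace ℂ (Fin 2)))
    (A B : Fin 2 → OrthonormalBasis (Fin 3) ℂ (EuclideanSpace ℂ (Fin 3))) : Prop :=
  ∀ i k, ‖⟪α i, β k⟫_ℂ‖ ^ 2 = 1 / 2 ∧ ∀ j, UnbiasedTo (A i) (B k j)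

variable {b b' : OrthonormalBasis (Fin 6) ℂ QubitQutrit}
  {α β γ : OrthonormalBasis (Fin 2) ℂ (EuclideanSpace ℂ (Fin 2))}
  {A B C : Fin 2 → OrthonormalBasis (Fin 3) ℂ (EuclideanSpace ℂ (Fin 3))} {v : QubitQutrit}

theorem SplitUnbiased.symm (h : SplitUnbiased α β A B) : SplitUnbiased β α B A := fun i k =>
  ⟨by rw [norm_inner_symm]; exact (h k i).1, fun j => UnbiasedTo.symm (h k i).2 j⟩

theorem Splits.normSq_inner_contract (hb : Splits b α A) (hv : ∀ k, ‖⟪b k, v⟫_ℂ‖ ^ 2 = 1 / 6)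
    (i : Fin 2) (j : Fin 3) : ‖⟪A i j, contract (α i) v⟫_ℂ‖ ^ 2 = 1 / 6 := by
  obtain ⟨k, hk⟩ := hb i j
  rw [inner_contract, ← hk, hv]

theorem Splits.normSq_contract (hb : Splits b α A) (hv : ∀ k, ‖⟪b k, v⟫_ℂ‖ ^ 2 = 1 / 6)
    (i : Fin 2) : ‖contract (α i) v‖ ^ 2 = 1 / 2 := by
  rw [← (A i).sum_sq_norm_inner_right]
  simp only [hb.normSq_inner_contract hv, Finset.sum_const, Finset.card_univ, Fintype.card_fin]
  norm_num

theorem Splits.unbiased_factors (hb : Splits b α A) {ψ : EuclideanSpace ℂ (Fin 2)}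
    {Ψ : EuclideanSpace ℂ (Fin 3)} (hΨ : ‖Ψ‖ = 1)
    (hv : ∀ k, ‖⟪b k, ψ ⊗ₜ[ℂ] Ψ⟫_ℂ‖ ^ 2 = 1 / 6) (i : Fin 2) :
    ‖⟪α i, ψ⟫_ℂ‖ ^ 2 = 1 / 2 ∧ UnbiasedTo (A i) Ψ := by
  have h1 := hb.normSq_contract hv i
  rw [contract_tmul, norm_smul, hΨ, mul_one] at h1
  refine ⟨h1, fun j => ?_⟩
  have h2 := hb.normSq_inner_contract hv i j
  rw [contract_tmul, inner_smul_right, norm_mul, mul_pow, h1] at h2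
  linarith

theorem Splits.splitUnbiased (hb : Splits b α A) (hb' : Splits b' β B)
    (h : MutuallyUnbiased b b') : SplitUnbiased α β A B := by
  intro i k
  have : ∀ j, ‖⟪α i, β k⟫_ℂ‖ ^ 2 = 1 / 2 ∧ UnbiasedTo (A i) (B k j) := by
    intro j
    obtain ⟨l, hl⟩ := hb' k j
    refine hb.unbiased_factors ((B k).orthonormal.1 j) (fun m => ?_) i
    rw [← hl]; exact h m l
  exact ⟨(this 0).1, fun j => (this j).2⟩

/-- The norms of the contractions with `β 0` and `γ 0` bound the cross term to zero real part in two
orthogonal directions of the equatorial plane of `α`. -/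
theorem inner_contract_eq_zero (h₁ : ∀ i k, ‖⟪α i, β k⟫_ℂ‖ ^ 2 = 1 / 2)
    (h₂ : ∀ i k, ‖⟪α i, γ k⟫_ℂ‖ ^ 2 = 1 / 2) (h₃ : ∀ i k, ‖⟪β i, γ k⟫_ℂ‖ ^ 2 = 1 / 2)
    (hα : ∀ i, ‖contract (α i) v‖ ^ 2 = 1 / 2) (hβ : ∀ i, ‖contract (β i) v‖ ^ 2 = 1 / 2)
    (hγ : ∀ i, ‖contract (γ i) v‖ ^ 2 = 1 / 2) :
    ⟪contract (α 0) v, contract (α 1) v⟫_ℂ = 0 := by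
  have key : ∀ y : EuclideanSpace ℂ (Fin 2), (∀ i, ‖⟪α i, y⟫_ℂ‖ ^ 2 = 1 / 2) →
      ‖contract y v‖ ^ 2 = 1 / 2 →
      (conj (coherence α y) * ⟪contract (α 0) v, contract (α 1) v⟫_ℂ).re = 0 := by
    intro y hy hv
    rw [contract_eq_sum α, norm_add_sq (𝕜 := ℂ), norm_smul, norm_smul, mul_pow, mul_pow, hα, hα,
      norm_inner_symm y, norm_inner_symm y, hy, hy, inner_smul_left, inner_smul_right,
      ← mul_assoc] at hv
    have : conj ⟪y, α 0⟫_ℂ * ⟪y, α 1⟫_ℂ = conj (coherence α y) := by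
      simp only [coherence, map_mul, inner_conj_symm]
    rw [this] at hv
    change _ + 2 * (conj (coherence α y) * ⟪contract (α 0) v, contract (α 1) v⟫_ℂ).re + _ = _ at hv
    linarith
  have hne : ∀ y : EuclideanSpace ℂ (Fin 2), (∀ i, ‖⟪α i, y⟫_ℂ‖ ^ 2 = 1 / 2) →
      conj (coherence α y) ≠ 0 := by
    intro y hy h0
    have := normSq_coherence hy
    rw [← RCLike.norm_conj, h0] at this
    norm_num at this
  refine eq_zero_of_re_mul_orthogonal (hne (β 0) (h₁ · 0)) (hne (γ 0) (h₂ · 0)) ?_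
    (key _ (h₁ · 0) (hβ 0)) (key _ (h₂ · 0) (hγ 0))
  rw [Complex.conj_conj, mul_comm]
  exact re_coherence_eq_zero (h₂ · 0) (h₁ · 0) (by rw [norm_inner_symm]; exact h₃ 0 0)

section Triple

variable {x y w : EuclideanSpace ℂ (Fin 3)}

theorem orthonormal_triple (hx : ‖x‖ = 1) (hy : ‖y‖ = 1) (hw : ‖w‖ = 1) (hxy : ⟪x, y⟫_ℂ = 0)
    (hxw : ⟪x, w⟫_ℂ = 0) (hyw : ⟪y, w⟫_ℂ = 0) :
    ∃ O : OrthonormalBasis (Fin 3) ℂ (EuclideanSpace ℂ (Fin 3)), O 0 = x ∧ O 1 = y ∧ O 2 = w := by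
  have h : Orthonormal ℂ ![x, y, w] := by
    refine ⟨fun i => by fin_cases i <;> simp [hx, hy, hw], fun i j hij => ?_⟩
    fin_cases i <;> fin_cases j <;> first | exact absurd rfl hij | skip
    · exact hxy
    · exact hxw
    · exact inner_eq_zero_symm.1 hxy
    · exact hyw
    · exact inner_eq_zero_symm.1 hxw
    · exact inner_eq_zero_symm.1 hyw
  obtain ⟨O, hO⟩ := Orthonormal.exists_orthonormalBasis_extension_of_card_eq (𝕜 := ℂ)
    (v := ![x, y, w]) (s := Set.univ) (by simp) (h.comp _ Subtype.val_injective)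
  exact ⟨O, hO 0 trivial, hO 1 trivial, hO 2 trivial⟩

theorem exists_third (hx : ‖x‖ = 1) (hy : ‖y‖ = 1) (hxy : ⟪x, y⟫_ℂ = 0) :
    ∃ w : EuclideanSpace ℂ (Fin 3), ‖w‖ = 1 ∧ ⟪x, w⟫_ℂ = 0 ∧ ⟪y, w⟫_ℂ = 0 := by
  have h : Orthonormal ℂ (({0, 1} : Set (Fin 3)).domRestrict ![x, y, 0]) := by
    refine ⟨?_, ?_⟩
    · rintro ⟨i, rfl | rfl⟩
      · exact hx
      · exact hy
    · rintro ⟨i, rfl | rfl⟩ ⟨j, rfl | rfl⟩ hij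
      · exact absurd rfl hij
      · exact hxy
      · exact inner_eq_zero_symm.1 hxy
      · exact absurd rfl hij
  obtain ⟨O, hO⟩ := Orthonormal.exists_orthonormalBasis_extension_of_card_eq (𝕜 := ℂ)
    (v := ![x, y, 0]) (s := {0, 1}) (by simp) h
  have h0 : O 0 = x := hO 0 (by simp)
  have h1 : O 1 = y := hO 1 (by simp)
  exact ⟨O 2, O.orthonormal.1 2, h0 ▸ O.inner_eq_zero (by decide), h1 ▸ O.inner_eq_zero (by decide)⟩

/-- If two members of an orthonormal triple are unbiased to a basis, so is the third. -/
theorem UnbiasedTo.third {A : OrthonormalBasis (Fin 3) ℂ (EuclideanSpace ℂ (Fin 3))}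
    (hx : ‖x‖ = 1) (hy : ‖y‖ = 1) (hw : ‖w‖ = 1) (hxy : ⟪x, y⟫_ℂ = 0)
    (hxw : ⟪x, w⟫_ℂ = 0) (hyw : ⟪y, w⟫_ℂ = 0) (hAx : UnbiasedTo A x) (hAy : UnbiasedTo A y) :
    UnbiasedTo A w := by
  obtain ⟨O, rfl, rfl, rfl⟩ := orthonormal_triple hx hy hw hxy hxw hyw
  intro j
  have := O.sum_sq_norm_inner_left (A j)
  rw [Fin.sum_univ_three, hAx, hAy, A.orthonormal.1] at this
  linarith

end Triple

theorem unbiasedTo_sqrt_two_smul {A : OrthonormalBasis (Fin 3) ℂ (EuclideanSpace ℂ (Fin 3))}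
    {x : EuclideanSpace ℂ (Fin 3)} (h : ∀ j, ‖⟪A j, x⟫_ℂ‖ ^ 2 = 1 / 6) :
    UnbiasedTo A (((√2 : ℝ) : ℂ) • x) := by
  intro j
  rw [inner_smul_right, norm_mul, mul_pow, h, Complex.norm_real, Real.norm_of_nonneg (by positivity),
    Real.sq_sqrt (by norm_num)]
  norm_num

theorem norm_sqrt_two_smul {x : EuclideanSpace ℂ (Fin 3)} (h : ‖x‖ ^ 2 = 1 / 2) :
    ‖((√2 : ℝ) : ℂ) • x‖ = 1 := by
  rw [← sq_eq_sq₀ (norm_nonneg _) zero_le_one, norm_smul, mul_pow, h, Complex.norm_real,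
    Real.norm_of_nonneg (by positivity), Real.sq_sqrt (by norm_num)]
  norm_num

theorem not_maximally_entangled (hαβ : SplitUnbiased α β A B)
    (hα : ∀ i, ‖contract (α i) v‖ ^ 2 = 1 / 2) (hβ : ∀ i, ‖contract (β i) v‖ ^ 2 = 1 / 2)
    (hA : ∀ i j, ‖⟪A i j, contract (α i) v⟫_ℂ‖ ^ 2 = 1 / 6)
    (hB : ∀ i j, ‖⟪B i j, contract (β i) v⟫_ℂ‖ ^ 2 = 1 / 6)
    (hα0 : ⟪contract (α 0) v, contract (α 1) v⟫_ℂ = 0)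
    (hβ0 : ⟪contract (β 0) v, contract (β 1) v⟫_ℂ = 0)
    (sA : ∀ p, UnbiasedTo (A 1) p → UnbiasedTo (A 0) p)
    (sB : ∀ p, UnbiasedTo (B 1) p → UnbiasedTo (B 0) p) : False := by
  have hAB : ∀ k, UnbiasedTo (A 0) (B 0 k) := (hαβ 0 0).2
  have ux := unbiasedTo_sqrt_two_smul (hA 0)
  have uy := sA _ (unbiasedTo_sqrt_two_smul (hA 1))
  have ux' := unbiasedTo_sqrt_two_smul (hB 0)
  have uy' := sB _ (unbiasedTo_sqrt_two_smul (hB 1))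
  have nx := norm_sqrt_two_smul (hα 0)
  have ny := norm_sqrt_two_smul (hα 1)
  have nx' := norm_sqrt_two_smul (hβ 0)
  have ny' := norm_sqrt_two_smul (hβ 1)
  have s2 : ((√2 : ℝ) : ℂ) ≠ 0 := by simp
  have e : ∀ φ, ((√2 : ℝ) : ℂ) • contract φ v = ⟪φ, α 0⟫_ℂ • (((√2 : ℝ) : ℂ) • contract (α 0) v)
      + ⟪φ, α 1⟫_ℂ • (((√2 : ℝ) : ℂ) • contract (α 1) v) := by
    intro φ
    conv_lhs => rw [contract_eq_sum α φ, smul_add, smul_comm _ ⟪φ, α 0⟫_ℂ, smul_comm _ ⟪φ, α 1⟫_ℂ]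
  have hxy : ⟪((√2 : ℝ) : ℂ) • contract (α 0) v, ((√2 : ℝ) : ℂ) • contract (α 1) v⟫_ℂ = 0 := by
    rw [inner_smul_left, inner_smul_right, hα0]; simp
  have hxy' : ⟪((√2 : ℝ) : ℂ) • contract (β 0) v, ((√2 : ℝ) : ℂ) • contract (β 1) v⟫_ℂ = 0 := by
    rw [inner_smul_left, inner_smul_right, hβ0]; simp
  have ex' := e (β 0)
  have ey' := e (β 1)
  generalize ((√2 : ℝ) : ℂ) • contract (α 0) v = x at *
  generalize ((√2 : ℝ) : ℂ) • contract (α 1) v = y at *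
  generalize ((√2 : ℝ) : ℂ) • contract (β 0) v = x' at *
  generalize ((√2 : ℝ) : ℂ) • contract (β 1) v = y' at *
  -- `w` is normal to the plane that `x`, `y` and also `x'`, `y'` span, so it is unbiased to both `A
  -- 0` and `B 0`.
  obtain ⟨w, nw, hxw, hyw⟩ := exists_third nx ny hxy
  have hxw' : ⟪x', w⟫_ℂ = 0 := by
    rw [ex', inner_add_left, inner_smul_left, inner_smul_left, hxw, hyw]; simp
  have hyw' : ⟪y', w⟫_ℂ = 0 := by
    rw [ey', inner_add_left, inner_smul_left, inner_smul_left, hxw, hyw]; simp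
  have uAw := UnbiasedTo.third nx ny nw hxy hxw hyw ux uy
  have uBw := UnbiasedTo.third nx' ny' nw hxy' hxw' hyw' ux' uy'
  have uBx := UnbiasedTo.of_orthogonal hAB uAw uBw ux (inner_eq_zero_symm.1 hxw)
  have uAx' := UnbiasedTo.of_orthogonal (fun k => UnbiasedTo.symm hAB k) uBw uAw ux'
    (inner_eq_zero_symm.1 hxw')
  have h := UnbiasedTo.overlap hAB ux uBx uAx' ux'
  -- The overlap is inherited from `α 0` and `β 0`, and is none of 0, 1, 1/3.
  have h12 : ‖⟪x, x'⟫_ℂ‖ ^ 2 = 1 / 2 := by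
    rw [ex', inner_add_right, inner_smul_right, inner_smul_right, hxy, mul_zero, add_zero,
      inner_self_eq_norm_sq_to_K, nx, norm_mul, mul_pow, norm_inner_symm, (hαβ 0 0).1]
    simp
  rw [h12] at h
  norm_num at h

/-- Among three mutually unbiased bases, at most one can have two different families of qutrit
factors. -/
theorem SplitUnbiased.not_both_unbiased (h₁ : SplitUnbiased α β A B) (h₂ : SplitUnbiased α γ A C)
    (h₃ : SplitUnbiased β γ B C) (uA : ∀ j, UnbiasedTo (A 0) (A 1 j))
    (uB : ∀ j, UnbiasedTo (B 0) (B 1 j)) : False :=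
  -- `A 0`, `A 1`, `B 0`, `B 1`, `C 0` would be five mutually unbiased bases of ℂ³.
  not_three_unbiased (A := A 0) (B := C 0) (p := B 0 0) (q := B 1 0) (t := A 1 0) (h₂ 0 0).2
    ((h₁ 0 0).2 0) ((h₃.symm 0 0).2 0) ((h₁ 0 1).2 0) ((h₃.symm 0 1).2 0) (uA 0)
    ((h₂.symm 0 1).2 0) (uB 0 0) ((h₁.symm 1 1).2 0 0) ((h₁.symm 0 1).2 0 0)

/-- No vector is unbiased to three mutually unbiased product bases. -/
theorem no_vector_unbiased_to_triple {b₁ b₂ b₃ : OrthonormalBasis (Fin 6) ℂ QubitQutrit}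
    (s₁ : Splits b₁ α A) (s₂ : Splits b₂ β B) (s₃ : Splits b₃ γ C) (h₁₂ : MutuallyUnbiased b₁ b₂)
    (h₁₃ : MutuallyUnbiased b₁ b₃) (h₂₃ : MutuallyUnbiased b₂ b₃)
    (v₁ : ∀ k, ‖⟪b₁ k, v⟫_ℂ‖ ^ 2 = 1 / 6) (v₂ : ∀ k, ‖⟪b₂ k, v⟫_ℂ‖ ^ 2 = 1 / 6)
    (v₃ : ∀ k, ‖⟪b₃ k, v⟫_ℂ‖ ^ 2 = 1 / 6) : False := by
  have u₁₂ := s₁.splitUnbiased s₂ h₁₂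
  have u₁₃ := s₁.splitUnbiased s₃ h₁₃
  have u₂₃ := s₂.splitUnbiased s₃ h₂₃
  have nα := s₁.normSq_contract v₁
  have nβ := s₂.normSq_contract v₂
  have nγ := s₃.normSq_contract v₃
  have oα := inner_contract_eq_zero (fun i k => (u₁₂ i k).1) (fun i k => (u₁₃ i k).1)
    (fun i k => (u₂₃ i k).1) nα nβ nγ
  have oβ := inner_contract_eq_zero (fun i k => (u₁₂.symm i k).1) (fun i k => (u₂₃ i k).1)
    (fun i k => (u₁₃ i k).1) nβ nα nγ
  have oγ := inner_contract_eq_zero (fun i k => (u₁₃.symm i k).1) (fun i k => (u₂₃.symm i k).1)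
    (fun i k => (u₁₂ i k).1) nγ nα nβ
  have iα := s₁.normSq_inner_contract v₁
  have iβ := s₂.normSq_inner_contract v₂
  have iγ := s₃.normSq_inner_contract v₃
  have dA := unbiased_or_same (u₂₃ 0 0).2 (u₁₂.symm 0 0).2 (u₁₂.symm 0 1).2 (u₁₃.symm 0 0).2
    (u₁₃.symm 0 1).2
  have dB := unbiased_or_same (u₁₃ 0 0).2 (u₁₂ 0 0).2 (u₁₂ 0 1).2 (u₂₃.symm 0 0).2
    (u₂₃.symm 0 1).2
  have dC := unbiased_or_same (u₁₂ 0 0).2 (u₁₃ 0 0).2 (u₁₃ 0 1).2 (u₂₃ 0 0).2 (u₂₃ 0 1).2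
  rcases dA with dA | dA <;> rcases dB with dB | dB
  · exact u₁₂.not_both_unbiased u₁₃ u₂₃ dA dB
  · rcases dC with dC | dC
    · exact u₁₃.not_both_unbiased u₁₂ u₂₃.symm dA dC
    · exact not_maximally_entangled u₂₃ nβ nγ iβ iγ oβ oγ dB dC
  · rcases dC with dC | dC
    · exact u₂₃.not_both_unbiased u₁₂.symm u₁₃.symm dB dC
    · exact not_maximally_entangled u₁₃ nα nγ iα iγ oα oγ dA dC
  · exact not_maximally_entangled u₁₂ nα nβ iα iβ oα oβ dA dB

theorem eq_smul_of_overlap_one (α : OrthonormalBasis (Fin 2) ℂ (EuclideanSpace ℂ (Fin 2)))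
    {x : EuclideanSpace ℂ (Fin 2)} (hx : ‖x‖ = 1)
    (h : ‖⟪α 0, x⟫_ℂ‖ ^ 2 = 0 ∨ ‖⟪α 0, x⟫_ℂ‖ ^ 2 = 1) :
    ∃ i, x = ⟪α i, x⟫_ℂ • α i ∧ ‖⟪α i, x⟫_ℂ‖ = 1 ∧ (i = 0 ↔ ‖⟪α 0, x⟫_ℂ‖ ^ 2 = 1) := by
  have e := α.sum_repr' x
  have n := normSq_qubit α x
  rw [Fin.sum_univ_two] at e
  rw [hx] at n
  rcases h with h | h
  · refine ⟨1, ?_, ?_, ?_⟩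
    · rw [sq_eq_zero_iff, norm_eq_zero] at h
      conv_lhs => rw [← e, h, zero_smul, zero_add]
    · rw [← sq_eq_sq₀ (norm_nonneg _) zero_le_one]; linarith
    · simp [h]
  · refine ⟨0, ?_, ?_, ?_⟩
    · have h1 : ⟪α 1, x⟫_ℂ = 0 := by
        rw [← norm_eq_zero, ← sq_eq_zero_iff]; linarith
      conv_lhs => rw [← e, h1, zero_smul, add_zero]
    · rw [← sq_eq_sq₀ (norm_nonneg _) zero_le_one]; linarith
    · simp [h]

theorem orthonormal_right_of_tmul {ι : Type*} {a : EuclideanSpace ℂ (Fin 2)} (ha : ‖a‖ = 1)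
    {Ψ : ι → EuclideanSpace ℂ (Fin 3)} (h : Orthonormal ℂ fun k => (a ⊗ₜ[ℂ] Ψ k : QubitQutrit)) :
    Orthonormal ℂ Ψ := by
  refine ⟨fun k => ?_, fun k l hkl => ?_⟩
  · have := h.1 k
    rwa [TensorProduct.norm_tmul, ha, one_mul] at this
  · have : ⟪(a ⊗ₜ[ℂ] Ψ k : QubitQutrit), a ⊗ₜ[ℂ] Ψ l⟫_ℂ = 0 := h.2 hkl
    change ⟪Ψ k, Ψ l⟫_ℂ = 0
    rwa [TensorProduct.inner_tmul, inner_self_eq_norm_sq_to_K, ha, RCLike.ofReal_one, one_pow,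
      one_mul] at this

theorem exists_splits {φ : Fin 6 → EuclideanSpace ℂ (Fin 2)}
    {Φ : Fin 6 → EuclideanSpace ℂ (Fin 3)} (hb : ∀ k, b k = φ k ⊗ₜ[ℂ] Φ k) (hφ : ∀ k, ‖φ k‖ = 1)
    (hΦ : ∀ k, ‖Φ k‖ = 1)
    (h : ∀ k l, ‖⟪φ k, φ l⟫_ℂ‖ ^ 2 = 0 ∨ ‖⟪φ k, φ l⟫_ℂ‖ ^ 2 = 1) :
    ∃ α A, Splits b α A := by
  obtain ⟨α, hα⟩ := exists_basis_qubit (hφ 0)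
  have h' : ∀ k, ∃ i, φ k = ⟪α i, φ k⟫_ℂ • α i ∧ ‖⟪α i, φ k⟫_ℂ‖ = 1 ∧
      (i = 0 ↔ ‖⟪α 0, φ k⟫_ℂ‖ ^ 2 = 1) := fun k =>
    eq_smul_of_overlap_one α (hφ k) (hα ▸ h 0 k)
  choose i hi ni hi0 using h'
  let Ψ : Fin 6 → EuclideanSpace ℂ (Fin 3) := fun k => ⟪α (i k), φ k⟫_ℂ • Φ k
  have hbΨ : ∀ k, b k = α (i k) ⊗ₜ[ℂ] Ψ k := by
    intro k
    rw [hb, ← TensorProduct.smul_tmul, ← hi]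
  -- The overlaps of `φ 0` with all qubit factors are 0 or 1 and sum to 3.
  have card0 : (Finset.univ.filter fun k => i k = 0).card = 3 := by
    have hs := sum_normSq_qubit hb hΦ (φ 0)
    rw [hφ] at hs
    have : ∀ k, ‖⟪φ k, φ 0⟫_ℂ‖ ^ 2 = if i k = 0 then 1 else 0 := by
      intro k
      rw [norm_inner_symm]
      split_ifs with hk
      · rw [← hα]; exact (hi0 k).1 hk
      · exact (h 0 k).resolve_right fun h1 => hk ((hi0 k).2 (hα ▸ h1))
    simp only [this, Finset.sum_boole] at hs
    norm_num at hs
    exact_mod_cast hs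
  have card : ∀ m, Fintype.card {k // i k = m} = 3 := by
    intro m
    rw [Fintype.card_subtype]
    fin_cases m
    · exact card0
    · have h2 := Finset.card_filter_add_card_filter_not (s := (Finset.univ : Finset (Fin 6)))
        (fun k => i k = 0)
      rw [card0, Finset.card_univ, Fintype.card_fin] at h2
      have : (Finset.univ.filter fun k => i k = 1) = Finset.univ.filter fun k => ¬ i k = 0 := by
        ext k
        have : ∀ m : Fin 2, m = 1 ↔ ¬ m = 0 := by decide
        simp [this]
      change (Finset.univ.filter fun k => i k = 1).card = 3
      rw [this]; omega
  have basis : ∀ m, ∃ O : OrthonormalBasis (Fin 3) ℂ (EuclideanSpace ℂ (Fin 3)),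
      ∀ j, ∃ k, b k = α m ⊗ₜ[ℂ] O j := by
    intro m
    let e := (Fintype.equivFinOfCardEq (card m)).symm
    have ho : Orthonormal ℂ fun j : Fin 3 => Ψ (e j) := by
      refine orthonormal_right_of_tmul (α.orthonormal.1 m) ?_
      have : (fun j : Fin 3 => (α m ⊗ₜ[ℂ] Ψ (e j) : QubitQutrit)) = fun j => b (e j) := by
        funext j
        rw [hbΨ, (e j).2]
      rw [this]
      exact b.orthonormal.comp _ (Subtype.val_injective.comp e.injective)
    obtain ⟨O, h0, h1, h2⟩ := orthonormal_triple (ho.1 0) (ho.1 1) (ho.1 2) (ho.2 (by decide))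
      (ho.2 (by decide)) (ho.2 (by decide))
    refine ⟨O, fun j => ⟨e j, ?_⟩⟩
    rw [hbΨ, (e j).2]
    congr 1
    fin_cases j
    · exact h0.symm
    · exact h1.symm
    · exact h2.symm
  choose A hA using basis
  exact ⟨α, A, hA⟩

end Splits

/-! ### Completing four product states to a product basis. -/

section Extension

variable {b₁ b₂ : OrthonormalBasis (Fin 6) ℂ QubitQutrit}
  {α β γ : OrthonormalBasis (Fin 2) ℂ (EuclideanSpace ℂ (Fin 2))}
  {A B : Fin 2 → OrthonormalBasis (Fin 3) ℂ (EuclideanSpace ℂ (Fin 3))} {E : QubitQutrit}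
  {O : OrthonormalBasis (Fin 3) ℂ (EuclideanSpace ℂ (Fin 3))}

theorem isProductState_of_contract_eq_zero (hE : ‖E‖ = 1) (m : Fin 2)
    (h : contract (γ m) E = 0) : IsProductState E := by
  have e := eq_sum_tmul_contract γ E
  have n := norm_contract_add γ E
  rw [hE] at n
  have norm_eq : ∀ x : EuclideanSpace ℂ (Fin 3), ‖x‖ ^ 2 = 1 → ‖x‖ = 1 := fun x hx => by
    rwa [← sq_eq_sq₀ (norm_nonneg _) zero_le_one, one_pow]
  fin_cases m
  · change contract (γ 0) E = 0 at h
    rw [h, norm_zero] at n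
    rw [h, TensorProduct.tmul_zero, zero_add] at e
    exact ⟨γ 1, _, γ.orthonormal.1 1, norm_eq _ (by linarith), e⟩
  · change contract (γ 1) E = 0 at h
    rw [h, norm_zero] at n
    rw [h, TensorProduct.tmul_zero, add_zero] at e
    exact ⟨γ 0, _, γ.orthonormal.1 0, norm_eq _ (by linarith), e⟩

theorem eq_zero_of_orthogonal_triple {x y w z : EuclideanSpace ℂ (Fin 3)} (hx : ‖x‖ = 1)
    (hy : ‖y‖ = 1) (hw : ‖w‖ = 1) (hxy : ⟪x, y⟫_ℂ = 0) (hxw : ⟪x, w⟫_ℂ = 0) (hyw : ⟪y, w⟫_ℂ = 0)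
    (h₁ : ⟪x, z⟫_ℂ = 0) (h₂ : ⟪y, z⟫_ℂ = 0) (h₃ : ⟪w, z⟫_ℂ = 0) : z = 0 := by
  obtain ⟨O, rfl, rfl, rfl⟩ := orthonormal_triple hx hy hw hxy hxw hyw
  rw [← O.sum_repr' z, Fin.sum_univ_three, h₁, h₂, h₃]
  simp

theorem normSq_inner_of_orthogonal_pair {x y z : EuclideanSpace ℂ (Fin 3)} (hx : ‖x‖ = 1)
    (hy : ‖y‖ = 1) (hxy : ⟪x, y⟫_ℂ = 0) (h₁ : ⟪x, z⟫_ℂ = 0) (h₂ : ⟪y, z⟫_ℂ = 0)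
    (ux : UnbiasedTo O x) (uy : UnbiasedTo O y) (j : Fin 3) :
    ‖⟪O j, z⟫_ℂ‖ ^ 2 = ‖z‖ ^ 2 / 3 := by
  obtain ⟨w, hw, hxw, hyw⟩ := exists_third hx hy hxy
  have uw := UnbiasedTo.third hx hy hw hxy hxw hyw ux uy
  obtain ⟨Q, rfl, rfl, rfl⟩ := orthonormal_triple hx hy hw hxy hxw hyw
  have hz : z = ⟪Q 2, z⟫_ℂ • Q 2 := by
    conv_lhs => rw [← Q.sum_repr' z, Fin.sum_univ_three, h₁, h₂, zero_smul, zero_smul, zero_add,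
      zero_add]
  rw [hz, inner_smul_right, norm_mul, mul_pow, uw, norm_smul, hw]
  ring

/-- The diagonal terms of the expanded overlap already add up to 1/6, leaving nothing for the cross
term. -/
theorem re_coherence_mul_inner_eq_zero (hE : ‖E‖ = 1) {a : EuclideanSpace ℂ (Fin 2)}
    (ha : ∀ i, ‖⟪γ i, a⟫_ℂ‖ ^ 2 = 1 / 2) (hO : ∀ j, ‖⟪O j, contract a E⟫_ℂ‖ ^ 2 = 1 / 6)
    (h₀ : ∀ j, ‖⟪O j, contract (γ 0) E⟫_ℂ‖ ^ 2 = ‖contract (γ 0) E‖ ^ 2 / 3)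
    (h₁ : ∀ j, ‖⟪O j, contract (γ 1) E⟫_ℂ‖ ^ 2 = ‖contract (γ 1) E‖ ^ 2 / 3) (j : Fin 3) :
    (conj (coherence γ a) * (conj ⟪O j, contract (γ 0) E⟫_ℂ * ⟪O j, contract (γ 1) E⟫_ℂ)).re
      = 0 := by
  have h := hO j
  rw [contract_eq_sum γ, inner_add_right, inner_smul_right, inner_smul_right, normSq_add, norm_mul,
    norm_mul, mul_pow, mul_pow, norm_inner_symm a, norm_inner_symm a, ha, ha, h₀, h₁] at h
  have e : conj (⟪a, γ 0⟫_ℂ * ⟪O j, contract (γ 0) E⟫_ℂ) * (⟪a, γ 1⟫_ℂ * ⟪O j, contract (γ 1) E⟫_ℂ)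
      = conj (coherence γ a) * (conj ⟪O j, contract (γ 0) E⟫_ℂ * ⟪O j, contract (γ 1) E⟫_ℂ) := by
    simp only [coherence, map_mul, inner_conj_symm]
    ring
  rw [e] at h
  have n := norm_contract_add γ E
  rw [hE] at n
  linarith

/-- The `g * t j` are three imaginary numbers of equal modulus; an odd number of equal lengths
cannot cancel by signs. -/
theorem eq_zero_of_sum_eq_zero {g : ℂ} {t : Fin 3 → ℂ} {c : ℝ} (hg : g ≠ 0)
    (ht : ∀ j, ‖t j‖ ^ 2 = c) (hre : ∀ j, (g * t j).re = 0) (hsum : ∑ j, t j = 0) : c = 0 := by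
  have hs : (g * t 0).im + (g * t 1).im + (g * t 2).im = 0 := by
    have : g * t 0 + g * t 1 + g * t 2 = 0 := by
      rw [Fin.sum_univ_three] at hsum
      linear_combination g * hsum
    simpa only [Complex.add_im, Complex.zero_im] using congrArg Complex.im this
  have hq : ∀ j, (g * t j).im ^ 2 = ‖g‖ ^ 2 * c := by
    intro j
    rw [← ht j, ← mul_pow, ← norm_mul, Complex.sq_norm, Complex.normSq_apply, hre j]
    ring
  have h0 := hq 0
  have h1 := hq 1
  have h2 := hq 2
  generalize (g * t 0).im = x at *
  generalize (g * t 1).im = y at *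
  generalize (g * t 2).im = z at *
  have hc : ‖g‖ ^ 2 * c = 0 := by
    have hz : z = -(x + y) := by linarith
    subst hz
    have hxy : x * y = -(‖g‖ ^ 2 * c) / 2 := by linarith
    have h3 : (x * y) ^ 2 = (‖g‖ ^ 2 * c) ^ 2 := by rw [mul_pow, h0, h1]; ring
    rw [hxy] at h3
    have : (‖g‖ ^ 2 * c) ^ 2 = 0 := by linarith
    exact pow_eq_zero_iff (two_ne_zero) |>.1 this
  exact (mul_eq_zero.1 hc).resolve_left (by simpa using hg)

/-- A state orthogonal to four orthonormal product states, and unbiased to the two product bases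
they are unbiased to, is a product state. -/
theorem isProductState_of_orthogonal {s : Fin 4 → QubitQutrit} (s₁ : Splits b₁ α A)
    (s₂ : Splits b₂ β B) (h₁₂ : MutuallyUnbiased b₁ b₂) (hos : Orthonormal ℂ s)
    {φ : Fin 4 → EuclideanSpace ℂ (Fin 2)} {Φ : Fin 4 → EuclideanSpace ℂ (Fin 3)}
    (hs : ∀ k, s k = φ k ⊗ₜ[ℂ] Φ k) (hφ : ∀ k, ‖φ k‖ = 1) (hΦ : ∀ k, ‖Φ k‖ = 1)
    (h01 : ∀ k l, ‖⟪φ k, φ l⟫_ℂ‖ ^ 2 = 0 ∨ ‖⟪φ k, φ l⟫_ℂ‖ ^ 2 = 1)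
    (u₁ : MutuallyUnbiased b₁ s) (u₂ : MutuallyUnbiased b₂ s) (hE : ‖E‖ = 1)
    (v₁ : ∀ k, ‖⟪b₁ k, E⟫_ℂ‖ ^ 2 = 1 / 6) (v₂ : ∀ k, ‖⟪b₂ k, E⟫_ℂ‖ ^ 2 = 1 / 6)
    (hsE : ∀ k, ⟪s k, E⟫_ℂ = 0) : IsProductState E := by
  obtain ⟨γ, hγ⟩ := exists_basis_qubit (hφ 0)
  have h' : ∀ k, ∃ i, φ k = ⟪γ i, φ k⟫_ℂ • γ i ∧ ‖⟪γ i, φ k⟫_ℂ‖ = 1 ∧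
      (i = 0 ↔ ‖⟪γ 0, φ k⟫_ℂ‖ ^ 2 = 1) := fun k =>
    eq_smul_of_overlap_one γ (hφ k) (hγ ▸ h01 0 k)
  choose i hi ni _ using h'
  obtain ⟨Ψ, hsΨ⟩ : ∃ Ψ : Fin 4 → EuclideanSpace ℂ (Fin 3), ∀ k, s k = γ (i k) ⊗ₜ[ℂ] Ψ k := by
    refine ⟨fun k => ⟪γ (i k), φ k⟫_ℂ • Φ k, fun k => ?_⟩
    rw [hs, ← TensorProduct.smul_tmul, ← hi]
  have nΨ : ∀ k, ‖Ψ k‖ = 1 := by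
    intro k
    have := hos.1 k
    rwa [hsΨ, TensorProduct.norm_tmul, γ.orthonormal.1, one_mul] at this
  have oΨ : ∀ k l, k ≠ l → i k = i l → ⟪Ψ k, Ψ l⟫_ℂ = 0 := by
    intro k l hkl hi
    have : ⟪s k, s l⟫_ℂ = 0 := hos.2 hkl
    rwa [hsΨ, hsΨ, TensorProduct.inner_tmul, hi, inner_self_eq_norm_sq_to_K, γ.orthonormal.1,
      RCLike.ofReal_one, one_pow, one_mul] at this
  have zΨ : ∀ m k, i k = m → ⟪Ψ k, contract (γ m) E⟫_ℂ = 0 := by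
    rintro m k rfl
    rw [inner_contract, ← hsΨ, hsE]
  -- Three states sharing a qubit factor fill ℂ³ and annihilate that contraction of `E`, so only the
  -- 2+2 split remains.
  have triple : ∀ m, 2 < (Finset.univ.filter fun k => i k = m).card → IsProductState E := by
    intro m hm
    obtain ⟨k, l, n, hk, hl, hn, hkl, hkn, hln⟩ := Finset.two_lt_card_iff.1 hm
    simp only [Finset.mem_filter, Finset.mem_univ, true_and] at hk hl hn
    exact isProductState_of_contract_eq_zero hE m (eq_zero_of_orthogonal_triple (nΨ k) (nΨ l) (nΨ n)
      (oΨ k l hkl (hk.trans hl.symm)) (oΨ k n hkn (hk.trans hn.symm))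
      (oΨ l n hln (hl.trans hn.symm)) (zΨ m k hk) (zΨ m l hl) (zΨ m n hn))
  by_contra hprod
  have hle : ∀ m, (Finset.univ.filter fun k => i k = m).card ≤ 2 := fun m =>
    not_lt.1 fun h => hprod (triple m h)
  have htot : (Finset.univ.filter fun k => i k = 0).card
      + (Finset.univ.filter fun k => i k = 1).card = 4 := by
    have h2 := Finset.card_filter_add_card_filter_not (s := (Finset.univ : Finset (Fin 4)))
      (fun k => i k = 0)
    have : (Finset.univ.filter fun k => i k = 1) = Finset.univ.filter fun k => ¬ i k = 0 := by
      ext k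
      have : ∀ m : Fin 2, m = 1 ↔ ¬ m = 0 := by decide
      simp [this]
    rw [this, h2, Finset.card_univ, Fintype.card_fin]
  have hge : ∀ m, 1 < (Finset.univ.filter fun k => i k = m).card := by
    have h0 := hle 0
    have h1 := hle 1
    intro m
    fin_cases m
    · change 1 < (Finset.univ.filter fun k => i k = 0).card
      omega
    · change 1 < (Finset.univ.filter fun k => i k = 1).card
      omega
  -- Each contraction is a multiple of the third vector completing an unbiased orthogonal pair.
  have pair : ∀ (O : OrthonormalBasis (Fin 3) ℂ (EuclideanSpace ℂ (Fin 3))),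
      (∀ k, UnbiasedTo O (Ψ k)) → ∀ m j,
      ‖⟪O j, contract (γ m) E⟫_ℂ‖ ^ 2 = ‖contract (γ m) E‖ ^ 2 / 3 := by
    intro O hO m
    obtain ⟨k, l, hk, hl, hkl⟩ := Finset.one_lt_card_iff.1 (hge m)
    simp only [Finset.mem_filter, Finset.mem_univ, true_and] at hk hl
    exact normSq_inner_of_orthogonal_pair (nΨ k) (nΨ l) (oΨ k l hkl (hk.trans hl.symm)) (zΨ m k hk)
      (zΨ m l hl) (hO k) (hO l)
  have f₁ : ∀ k, ‖⟪α 0, φ k⟫_ℂ‖ ^ 2 = 1 / 2 := fun k =>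
    (s₁.unbiased_factors (hΦ k) (fun l => by rw [← hs]; exact u₁ l k) 0).1
  have f₂ : ∀ k, ‖⟪β 0, φ k⟫_ℂ‖ ^ 2 = 1 / 2 := fun k =>
    (s₂.unbiased_factors (hΦ k) (fun l => by rw [← hs]; exact u₂ l k) 0).1
  have hγα : ∀ i, ‖⟪γ i, α 0⟫_ℂ‖ ^ 2 = 1 / 2 :=
    unbiased_both (α.orthonormal.1 0) (by rw [norm_inner_symm, hγ]; exact f₁ 0)
  have hγβ : ∀ i, ‖⟪γ i, β 0⟫_ℂ‖ ^ 2 = 1 / 2 :=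
    unbiased_both (β.orthonormal.1 0) (by rw [norm_inner_symm, hγ]; exact f₂ 0)
  have uA : ∀ k, UnbiasedTo (A 0) (Ψ k) := fun k =>
    (s₁.unbiased_factors (nΨ k) (fun l => by rw [← hsΨ]; exact u₁ l k) 0).2
  have uB : ∀ k, UnbiasedTo (B 0) (Ψ k) := fun k =>
    (s₂.unbiased_factors (nΨ k) (fun l => by rw [← hsΨ]; exact u₂ l k) 0).2
  have rA := re_coherence_mul_inner_eq_zero hE hγα (s₁.normSq_inner_contract v₁ 0)
    (pair _ uA 0) (pair _ uA 1)
  have rB := re_coherence_mul_inner_eq_zero hE hγβ (s₂.normSq_inner_contract v₂ 0)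
    (pair _ uB 0) (pair _ uB 1)
  have hsum : ∀ O : OrthonormalBasis (Fin 3) ℂ (EuclideanSpace ℂ (Fin 3)),
      ∑ j, conj ⟪O j, contract (γ 0) E⟫_ℂ * ⟪O j, contract (γ 1) E⟫_ℂ
        = ⟪contract (γ 0) E, contract (γ 1) E⟫_ℂ := by
    intro O
    rw [← O.sum_inner_mul_inner]
    simp only [inner_conj_symm]
  have hne : ∀ y : EuclideanSpace ℂ (Fin 2), (∀ i, ‖⟪γ i, y⟫_ℂ‖ ^ 2 = 1 / 2) →
      conj (coherence γ y) ≠ 0 := by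
    intro y hy h0
    have := normSq_coherence hy
    rw [← RCLike.norm_conj, h0] at this
    norm_num at this
  have hXY : ⟪contract (γ 0) E, contract (γ 1) E⟫_ℂ = 0 := by
    refine eq_zero_of_re_mul_orthogonal (hne _ hγα) (hne _ hγβ) ?_ ?_ ?_
    · rw [Complex.conj_conj, mul_comm]
      refine re_coherence_eq_zero hγβ hγα ?_
      rw [norm_inner_symm]
      exact (s₁.splitUnbiased s₂ h₁₂ 0 0).1
    · rw [← hsum (A 0), Finset.mul_sum, Complex.re_sum]
      exact Finset.sum_eq_zero fun j _ => rA j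
    · rw [← hsum (B 0), Finset.mul_sum, Complex.re_sum]
      exact Finset.sum_eq_zero fun j _ => rB j
  have hc := eq_zero_of_sum_eq_zero (hne _ hγα)
    (c := ‖contract (γ 0) E‖ ^ 2 / 3 * (‖contract (γ 1) E‖ ^ 2 / 3))
    (fun j => by rw [norm_mul, mul_pow, RCLike.norm_conj, pair _ uA 0, pair _ uA 1]) rA
    ((hsum (A 0)).trans hXY)
  rcases mul_eq_zero.1 hc with h | h
  · exact hprod (isProductState_of_contract_eq_zero (γ := γ) hE 0 (by simpa using h))
  · exact hprod (isProductState_of_contract_eq_zero (γ := γ) hE 1 (by simpa using h))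

end Extension

/-! ### States up to phase, and the theorem. -/

section States

variable {v w x : QubitQutrit} {B : Fin 7 → OrthonormalBasis (Fin 6) ℂ QubitQutrit}

theorem SameState.norm_inner_left (h : SameState v w) (x : QubitQutrit) :
    ‖⟪v, x⟫_ℂ‖ = ‖⟪w, x⟫_ℂ‖ := by
  obtain ⟨c, hc, rfl⟩ := h
  have := inner_smul_left (𝕜 := ℂ) v x c
  rw [show ⟪c • v, x⟫_ℂ = _ from this, norm_mul, RCLike.norm_conj, hc, one_mul]

theorem SameState.norm_inner_right (h : SameState v w) (x : QubitQutrit) :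
    ‖⟪x, v⟫_ℂ‖ = ‖⟪x, w⟫_ℂ‖ := by
  exact (norm_inner_symm (𝕜 := ℂ) x v).trans
    ((h.norm_inner_left x).trans (norm_inner_symm (𝕜 := ℂ) w x))

/-- Orthonormal states occurring in a complete set of mutually unbiased bases all occur in the same
basis. -/
theorem exists_common_basis {n : ℕ} {u : Fin (n + 1) → QubitQutrit} (hB : IsCompleteMUSet B)
    (hu : Orthonormal ℂ u) (h : ∀ k, OccursIn (u k) B) : ∃ i, ∀ k, ∃ l, SameState (u k) (B i l) := by
  choose i l hl using h
  refine ⟨i 0, fun k => ?_⟩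
  by_cases hi : i k = i 0
  · exact ⟨l k, hi ▸ hl k⟩
  · exfalso
    have hk : k ≠ 0 := by rintro rfl; exact hi rfl
    have h1 := hB _ _ hi (l k) (l 0)
    rw [← (hl k).norm_inner_left, ← (hl 0).norm_inner_right,
      show ⟪u k, u 0⟫_ℂ = 0 from hu.2 hk] at h1
    norm_num at h1

theorem ne_of_unbiased {i i' : Fin 7} {l l' : Fin 6} (h : SameState v (B i l))
    (h' : SameState w (B i' l')) (hvw : ‖⟪v, w⟫_ℂ‖ ^ 2 = 1 / 6) : i ≠ i' := by
  rintro rfl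
  rw [h.norm_inner_left, h'.norm_inner_right] at hvw
  rcases eq_or_ne l l' with rfl | hl
  · have h1 := inner_self_eq_norm_sq_to_K (𝕜 := ℂ) (B i l)
    rw [(B i).orthonormal.1] at h1
    rw [h1] at hvw
    norm_num at hvw
  · rw [(B i).inner_eq_zero hl] at hvw
    norm_num at hvw

theorem IsProductState.of_sameState (hv : IsProductState v) (h : SameState v w) :
    IsProductState w := by
  obtain ⟨φ, Φ, hφ, hΦ, rfl⟩ := hv
  obtain ⟨c, hc, rfl⟩ := h
  exact ⟨c • φ, Φ, by rw [norm_smul, hc, hφ, one_mul], hΦ, TensorProduct.smul_tmul' c φ Φ⟩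

end States

theorem theorem2
    (b₁ b₂ : OrthonormalBasis (Fin 6) ℂ QubitQutrit) (s : Fin 4 → QubitQutrit)
    (h : IsMUProductConstellation554 b₁ b₂ s) :
    ¬ ∃ B : Fin 7 → OrthonormalBasis (Fin 6) ℂ QubitQutrit,
      IsCompleteMUSet B ∧
        (∀ k, OccursIn (b₁ k) B) ∧ (∀ k, OccursIn (b₂ k) B) ∧ (∀ k, OccursIn (s k) B) := by
  rintro ⟨B, hB, o₁, o₂, os⟩
  obtain ⟨i₁, hi₁⟩ := exists_common_basis hB b₁.orthonormal o₁
  obtain ⟨i₂, hi₂⟩ := exists_common_basis hB b₂.orthonormal o₂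
  obtain ⟨i₃, hi₃⟩ := exists_common_basis hB h.orthonormal_quad os
  choose l₁ hl₁ using hi₁
  choose l₂ hl₂ using hi₂
  choose l₃ hl₃ using hi₃
  have n₁₃ : i₁ ≠ i₃ := ne_of_unbiased (hl₁ 0) (hl₃ 0) (h.unbiased_left_quad 0 0)
  have n₂₃ : i₂ ≠ i₃ := ne_of_unbiased (hl₂ 0) (hl₃ 0) (h.unbiased_right_quad 0 0)
  -- One further basis of the seven is enough.
  obtain ⟨m, m₁, m₂, m₃⟩ : ∃ m : Fin 7, i₁ ≠ m ∧ i₂ ≠ m ∧ i₃ ≠ m := by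
    clear * -
    revert i₁ i₂ i₃
    decide
  have u₁ : ∀ j, i₁ ≠ j → MutuallyUnbiased b₁ (B j) := fun j hj k l => by
    rw [(hl₁ k).norm_inner_left]; exact hB _ _ hj _ _
  have u₂ : ∀ j, i₂ ≠ j → MutuallyUnbiased b₂ (B j) := fun j hj k l => by
    rw [(hl₂ k).norm_inner_left]; exact hB _ _ hj _ _
  choose φ₁ Φ₁ nφ₁ nΦ₁ e₁ using h.product_left
  choose φ₂ Φ₂ nφ₂ nΦ₂ e₂ using h.product_right
  choose φ Φ nφ nΦ e using h.product_quad
  have q₁₂ : ∀ k l, ‖⟪φ₁ k, φ₂ l⟫_ℂ‖ ^ 2 = 1 / 2 := fun k l =>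
    qubit_unbiased e₁ nφ₁ nΦ₁ (nφ₂ l) (nΦ₂ l) (fun j => by rw [← e₂]; exact h.unbiased_bases j l) k
  have q₁ : ∀ k l, ‖⟪φ₁ k, φ l⟫_ℂ‖ ^ 2 = 1 / 2 := fun k l =>
    qubit_unbiased e₁ nφ₁ nΦ₁ (nφ l) (nΦ l) (fun j => by rw [← e]; exact h.unbiased_left_quad j l) k
  have q₂ : ∀ k l, ‖⟪φ₂ k, φ l⟫_ℂ‖ ^ 2 = 1 / 2 := fun k l =>
    qubit_unbiased e₂ nφ₂ nΦ₂ (nφ l) (nΦ l)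
      (fun j => by rw [← e]; exact h.unbiased_right_quad j l) k
  obtain ⟨α, A₁, s₁⟩ := exists_splits e₁ nφ₁ nΦ₁ fun k l =>
    qubit_overlap (nφ₂ 0) (nφ 0) (nφ₁ k) (nφ₁ l) (q₂ 0 0) (by rw [norm_inner_symm]; exact q₁₂ k 0)
      (by rw [norm_inner_symm]; exact q₁₂ l 0) (by rw [norm_inner_symm]; exact q₁ k 0)
      (by rw [norm_inner_symm]; exact q₁ l 0)
  obtain ⟨β, A₂, s₂⟩ := exists_splits e₂ nφ₂ nΦ₂ fun k l =>
    qubit_overlap (nφ₁ 0) (nφ 0) (nφ₂ k) (nφ₂ l) (q₁ 0 0) (q₁₂ 0 k) (q₁₂ 0 l)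
      (by rw [norm_inner_symm]; exact q₂ k 0) (by rw [norm_inner_symm]; exact q₂ l 0)
  -- A member of `B i₃` either represents some `s k` or is orthogonal to all four.
  have hprod : ∀ l, IsProductState (B i₃ l) := by
    intro l
    by_cases hl : ∃ k, l₃ k = l
    · obtain ⟨k, rfl⟩ := hl
      exact (h.product_quad k).of_sameState (hl₃ k)
    · refine isProductState_of_orthogonal s₁ s₂ h.unbiased_bases h.orthonormal_quad e nφ nΦ
        (fun k l => qubit_overlap (nφ₁ 0) (nφ₂ 0) (nφ k) (nφ l) (q₁₂ 0 0) (q₁ 0 k) (q₁ 0 l) (q₂ 0 k)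
          (q₂ 0 l)) h.unbiased_left_quad h.unbiased_right_quad ((B i₃).orthonormal.1 l)
        (fun k => u₁ i₃ n₁₃ k l) (fun k => u₂ i₃ n₂₃ k l) fun k => ?_
      rw [← norm_eq_zero, (hl₃ k).norm_inner_left,
        (B i₃).inner_eq_zero (fun hk => hl ⟨k, hk⟩), norm_zero]
  choose φ₃ Φ₃ nφ₃ nΦ₃ e₃ using hprod
  have q₁₃ : ∀ k l, ‖⟪φ₁ k, φ₃ l⟫_ℂ‖ ^ 2 = 1 / 2 := fun k l =>
    qubit_unbiased e₁ nφ₁ nΦ₁ (nφ₃ l) (nΦ₃ l) (fun j => by rw [← e₃]; exact u₁ i₃ n₁₃ j l) k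
  have q₂₃ : ∀ k l, ‖⟪φ₂ k, φ₃ l⟫_ℂ‖ ^ 2 = 1 / 2 := fun k l =>
    qubit_unbiased e₂ nφ₂ nΦ₂ (nφ₃ l) (nΦ₃ l) (fun j => by rw [← e₃]; exact u₂ i₃ n₂₃ j l) k
  obtain ⟨γ, A₃, s₃⟩ := exists_splits e₃ nφ₃ nΦ₃ fun k l =>
    qubit_overlap (nφ₁ 0) (nφ₂ 0) (nφ₃ k) (nφ₃ l) (q₁₂ 0 0) (q₁₃ 0 k) (q₁₃ 0 l) (q₂₃ 0 k) (q₂₃ 0 l)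
  exact no_vector_unbiased_to_triple (v := B m 0) s₁ s₂ s₃ h.unbiased_bases (u₁ i₃ n₁₃)
    (u₂ i₃ n₂₃) (fun k => u₁ m m₁ k 0) (fun k => u₂ m m₂ k 0) (fun k => hB i₃ m m₃ k 0)
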